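/- Let $\mathcal M\subseteq B(H)$ be a von Neumann algebra equipped with a faithful normal tracial state $\tau$ (so $\mathcal M$ is finite), let $N>1$ be an integer, and let $u_1,\dots,u_N$ be unitaries in $\mathcal M$. Let $\mathcal M^{\mathrm{op}}$ denote the opposite von Neumann algebra, $x\mapsto x^{\mathrm{op}}$ the canonical map $\mathcal M\to\mathcal M^{\mathrm{op}}$ (linear, $*$-preserving, with $(xy)^{\mathrm{op}}=y^{\mathrm{op}}x^{\mathrm{op}}$), and $\overline\otimes$ the von Neumann algebra tensor product. Then the following assertions are equivalent: 1. $u_1,\dots,u_N$ are free Haar unitaries with respect to $\tau$, that is, $\tau(u_i^k)=0$ for every $i$ and every $k\in\mathbb Z\setminus\{0\}$, and the $*$-subalgebras $A_i$ of $\mathcal M$ generated by $u_i$ are free: $\tau(a_1\cdots a_n)=0$ whenever $n\ge 1$, $a_j\in A_{i_j}$ and $\tau(a_j)=0$ for all $j$, and $i_j\ne i_{j+1}$ for $1\le j<n$; 2. $\displaystyle \Big\| \sum_{i=1}^N \big(u_i\otimes (u_i^{\mathrm{op}})^* + u_i^*\otimes u_i^{\mathrm{op}}\big)\Big\|_{\mathcal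 M\overline\otimes\mathcal M^{\mathrm{op}}} = 2\sqrt{2N-1}.$ -/

import Mathlib

open scoped TensorProduct InnerProductSpace ComplexOrder

noncomputable section

universe u v

/-! ### The dual Hilbert space and transposition -/

/-- The dual `H*` of a Hilbert space `H`, as a type of its own. It is the conjugate Hilbert space
of `H`, through the Riesz representation. -/
def DualHilbert (H : Type u) [NormedAddCommGroup H] [InnerProductSpace ℂ H] : Type u :=
  StrongDual ℂ H

section

variable {H : Type u} [NormedAddCommGroup H] [InnerProductSpace ℂ H]

instance : NormedAddCommGroup (DualHilbert H) := inferInstanceAs (NormedAddCommGroup (StrongDual ℂ H))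

instance : NormedSpace ℂ (DualHilbert H) := inferInstanceAs (NormedSpace ℂ (StrongDual ℂ H))

instance : CompleteSpace (DualHilbert H) := inferInstanceAs (CompleteSpace (StrongDual ℂ H))

instance : FunLike (DualHilbert H) H ℂ := inferInstanceAs (FunLike (StrongDual ℂ H) H ℂ)

@[ext]
theorem DualHilbert.ext {f g : DualHilbert H} (h : ∀ ξ, f ξ = g ξ) : f = g := DFunLike.ext f g h

@[simp] theorem DualHilbert.add_apply (f g : DualHilbert H) (ξ : H) : (f + g) ξ = f ξ + g ξ := rfl

@[simp] theorem DualHilbert.smul_apply (c : ℂ) (f : DualHilbert H) (ξ : H) :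
    (c • f) ξ = c * f ξ := rfl

variable [CompleteSpace H]

/-- The Riesz representation `ξ ↦ ⟪ξ, ·⟫`, as a conjugate-linear isometry of `H` onto `H*`. -/
def riesz (H : Type u) [NormedAddCommGroup H] [InnerProductSpace ℂ H] [CompleteSpace H] :
    H ≃ₗᵢ⋆[ℂ] DualHilbert H :=
  InnerProductSpace.toDual ℂ H

@[simp] theorem riesz_apply (η ξ : H) : riesz H η ξ = ⟪η, ξ⟫_ℂ := rfl

@[simp] theorem inner_riesz_symm (f : DualHilbert H) (ξ : H) : ⟪(riesz H).symm f, ξ⟫_ℂ = f ξ :=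
  InnerProductSpace.toDual_symm_apply

/-- The Hilbert space structure on `H*`, for the usual dual norm. -/
instance : InnerProductSpace ℂ (DualHilbert H) where
  inner f g := ⟪(riesz H).symm g, (riesz H).symm f⟫_ℂ
  norm_sq_eq_re_inner f := by
    rw [inner_self_eq_norm_sq, LinearIsometryEquiv.norm_map]
  conj_inner_symm f g := inner_conj_symm _ _
  add_left f g h := by rw [map_add, inner_add_right]
  smul_left f g r := by
    rw [LinearIsometryEquiv.map_smulₛₗ, inner_smul_right]

theorem dual_inner_def (f g : DualHilbert H) :
    ⟪f, g⟫_ℂ = ⟪(riesz H).symm g, (riesz H).symm f⟫_ℂ := rfl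

/-- The transpose of a bounded operator `x` on `H`: the bounded operator `f ↦ f ∘ x` on `H*`. -/
def transposeOp (x : H →L[ℂ] H) : DualHilbert H →L[ℂ] DualHilbert H :=
  ((ContinuousLinearMap.compL ℂ H H ℂ).flip x : StrongDual ℂ H →L[ℂ] StrongDual ℂ H)

@[simp]
theorem transposeOp_apply (x : H →L[ℂ] H) (f : DualHilbert H) (ξ : H) :
    transposeOp x f ξ = f (x ξ) := rfl

theorem transposeOp_add (x y : H →L[ℂ] H) :
    transposeOp (x + y) = transposeOp x + transposeOp y := by
  ext f ξ
  exact ContinuousLinearMap.map_add (f : StrongDual ℂ H) (x ξ) (y ξ)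

theorem transposeOp_mul (x y : H →L[ℂ] H) :
    transposeOp (x * y) = transposeOp y * transposeOp x := rfl

theorem transposeOp_algebraMap (c : ℂ) :
    transposeOp (algebraMap ℂ (H →L[ℂ] H) c) =
      algebraMap ℂ (DualHilbert H →L[ℂ] DualHilbert H) c := by
  ext f ξ
  exact ContinuousLinearMap.map_smul (f : StrongDual ℂ H) c ξ

theorem transposeOp_star (x : H →L[ℂ] H) : transposeOp (star x) = star (transposeOp x) := by
  rw [ContinuousLinearMap.star_eq_adjoint (transposeOp x), ContinuousLinearMap.eq_adjoint_iff]
  intro f g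
  have key : ∀ (a : H →L[ℂ] H) (h : DualHilbert H),
      (riesz H).symm (transposeOp a h) = (star a) ((riesz H).symm h) := by
    intro a h
    refine ext_inner_right ℂ fun ξ ↦ ?_
    rw [inner_riesz_symm, ContinuousLinearMap.star_eq_adjoint,
      ContinuousLinearMap.adjoint_inner_left, inner_riesz_symm, transposeOp_apply]
  rw [dual_inner_def, dual_inner_def, key, key, star_star, ContinuousLinearMap.star_eq_adjoint,
    ContinuousLinearMap.adjoint_inner_left]

theorem transposeOp_injective :
    Function.Injective (transposeOp : (H →L[ℂ] H) → DualHilbert H →L[ℂ] DualHilbert H) := by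
  intro x y hxy
  ext ξ
  refine ext_inner_left ℂ fun η ↦ ?_
  have := congrArg (fun T ↦ T (riesz H η) ξ) hxy
  simpa using this

theorem transposeOp_surjective :
    Function.Surjective (transposeOp : (H →L[ℂ] H) → DualHilbert H →L[ℂ] DualHilbert H) := by
  intro T
  let z : H →L[ℂ] H :=
    ((riesz H).symm.toContinuousLinearEquiv : DualHilbert H →SL[starRingEnd ℂ] H).comp
      (T.comp ((riesz H).toContinuousLinearEquiv : H →SL[starRingEnd ℂ] DualHilbert H))
  have hz : ∀ η, z η = (riesz H).symm (T (riesz H η)) := fun _ ↦ rfl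
  refine ⟨star z, ?_⟩
  ext f ξ
  obtain ⟨η, rfl⟩ := (riesz H).surjective f
  rw [transposeOp_apply, riesz_apply, ContinuousLinearMap.star_eq_adjoint,
    ContinuousLinearMap.adjoint_inner_right, hz, inner_riesz_symm]

namespace VonNeumannAlgebra

/-- The opposite von Neumann algebra `M^op`, faithfully represented on `H*` by transposition:
`M^op = {x^t : x ∈ M}`. -/
def opposite (M : VonNeumannAlgebra H) : VonNeumannAlgebra (DualHilbert H) where
  carrier := transposeOp '' (M : Set (H →L[ℂ] H))
  mul_mem' := by
    rintro _ _ ⟨x, hx, rfl⟩ ⟨y, hy, rfl⟩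
    exact ⟨y * x, mul_mem hy hx, transposeOp_mul y x⟩
  add_mem' := by
    rintro _ _ ⟨x, hx, rfl⟩ ⟨y, hy, rfl⟩
    exact ⟨x + y, add_mem hx hy, transposeOp_add x y⟩
  algebraMap_mem' c := ⟨algebraMap ℂ _ c, M.algebraMap_mem' c, transposeOp_algebraMap c⟩
  star_mem' := by
    rintro _ ⟨x, hx, rfl⟩
    exact ⟨star x, star_mem hx, transposeOp_star x⟩
  centralizer_centralizer' := by
    refine Set.Subset.antisymm ?_ Set.subset_centralizer_centralizer
    intro T hT
    obtain ⟨y, rfl⟩ := transposeOp_surjective T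
    refine ⟨y, ?_, rfl⟩
    rw [← M.centralizer_centralizer]
    intro z hz
    have hzt : transposeOp z ∈ Set.centralizer (transposeOp '' (M : Set (H →L[ℂ] H))) := by
      rintro _ ⟨x, hx, rfl⟩
      rw [← transposeOp_mul, ← transposeOp_mul, hz x hx]
    have := hT _ hzt
    rw [← transposeOp_mul, ← transposeOp_mul] at this
    exact (transposeOp_injective this).symm

/-- The canonical map `x ↦ x^op` from `M` to `M^op`. -/
def toOpposite (M : VonNeumannAlgebra H) (x : M.toStarSubalgebra) :
    M.opposite.toStarSubalgebra :=
  ⟨transposeOp (x : H →L[ℂ] H), x, x.2, rfl⟩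

/-- The von Neumann algebra generated by a set `s` of bounded operators: the double commutant of
`s ∪ s*`. -/
def generatedBy (s : Set (H →L[ℂ] H)) : VonNeumannAlgebra H where
  toStarSubalgebra :=
    StarSubalgebra.centralizer ℂ (StarSubalgebra.centralizer ℂ s : Set (H →L[ℂ] H))
  centralizer_centralizer' := by
    change Set.centralizer (Set.centralizer
      (StarSubalgebra.centralizer ℂ (StarSubalgebra.centralizer ℂ s : Set (H →L[ℂ] H)) :
        Set (H →L[ℂ] H)))
      = (StarSubalgebra.centralizer ℂ (StarSubalgebra.centralizer ℂ s : Set (H →L[ℂ] H)) :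
        Set (H →L[ℂ] H))
    rw [StarSubalgebra.coe_centralizer_centralizer, Set.centralizer_centralizer_centralizer]

theorem subset_generatedBy (s : Set (H →L[ℂ] H)) :
    s ⊆ ((generatedBy s).toStarSubalgebra : Set (H →L[ℂ] H)) := by
  change s ⊆ (StarSubalgebra.centralizer ℂ (StarSubalgebra.centralizer ℂ s : Set (H →L[ℂ] H)) :
    Set (H →L[ℂ] H))
  rw [StarSubalgebra.coe_centralizer_centralizer]
  exact Set.subset_union_left.trans Set.subset_centralizer_centralizer

end VonNeumannAlgebra

end

/-! ### The tensor product of von Neumann algebras -/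

/-- The Hilbert space tensor product `H ⊗ K`: the completion of the algebraic tensor product for
the inner product `⟪ξ ⊗ η, ξ' ⊗ η'⟫ = ⟪ξ, ξ'⟫ ⟪η, η'⟫`. -/
abbrev HilbertTensor (H : Type u) (K : Type v) [NormedAddCommGroup H] [InnerProductSpace ℂ H]
    [NormedAddCommGroup K] [InnerProductSpace ℂ K] : Type (max u v) :=
  UniformSpace.Completion (H ⊗[ℂ] K)

section

variable {H : Type u} [NormedAddCommGroup H] [InnerProductSpace ℂ H]
  {K : Type v} [NormedAddCommGroup K] [InnerProductSpace ℂ K]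

/-- The bounded operator `x ⊗ y` on the Hilbert space tensor product `H ⊗ K`. -/
def tensorOp (x : H →L[ℂ] H) (y : K →L[ℂ] K) : HilbertTensor H K →L[ℂ] HilbertTensor H K :=
  (TensorProduct.mapL x y).completion

namespace VonNeumannAlgebra

variable [CompleteSpace H] [CompleteSpace K]

/-- The von Neumann algebra tensor product `M ⊗̄ N`: the von Neumann algebra on the Hilbert space
tensor product generated by the operators `x ⊗ y` with `x ∈ M` and `y ∈ N`. -/
def tensor (M : VonNeumannAlgebra H) (N : VonNeumannAlgebra K) :
    VonNeumannAlgebra (HilbertTensor H K) :=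
  generatedBy {T | ∃ x ∈ M, ∃ y ∈ N, T = tensorOp x y}

/-- The elementary tensor `x ⊗ y` as an element of `M ⊗̄ N`. -/
def tmul {M : VonNeumannAlgebra H} {N : VonNeumannAlgebra K}
    (x : M.toStarSubalgebra) (y : N.toStarSubalgebra) : (M.tensor N).toStarSubalgebra :=
  ⟨tensorOp (x : H →L[ℂ] H) (y : K →L[ℂ] K),
    subset_generatedBy _ ⟨x, x.2, y, y.2, rfl⟩⟩

end VonNeumannAlgebra

end

/-! ### Traces -/

/-- The ultraweak (σ-weak) topology on the bounded operators on `H`: the initial topology for the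
functionals `x ↦ ∑ₙ ⟪ηₙ, x ξₙ⟫`, where `(ξₙ)` and `(ηₙ)` are square-summable sequences in `H`. -/
@[reducible]
def ultraweakTopology (H : Type u) [NormedAddCommGroup H] [InnerProductSpace ℂ H] :
    TopologicalSpace (H →L[ℂ] H) :=
  ⨅ (ξ : lp (fun _ : ℕ ↦ H) 2) (η : lp (fun _ : ℕ ↦ H) 2),
    TopologicalSpace.induced (fun x : H →L[ℂ] H ↦ ∑' n, ⟪η n, x (ξ n)⟫_ℂ) inferInstance

/-- `τ` is a faithful normal tracial state on the von Neumann algebra `M`; normal means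
ultraweakly continuous. -/
structure IsFaithfulNormalTrace {H : Type u} [NormedAddCommGroup H] [InnerProductSpace ℂ H]
    [CompleteSpace H] (M : VonNeumannAlgebra H) (τ : M.toStarSubalgebra →ₗ[ℂ] ℂ) : Prop where
  map_one : τ 1 = 1
  nonneg : ∀ x, 0 ≤ τ (star x * x)
  faithful : ∀ x, τ (star x * x) = 0 → x = 0
  tracial : ∀ x y, τ (x * y) = τ (y * x)
  normal : @Continuous _ _ (TopologicalSpace.induced Subtype.val (ultraweakTopology H))
    inferInstance τ

/-! ### Freeness -/

/-- A unitary `u` is a Haar unitary for `τ` if `τ (u ^ k) = 0` for every nonzero integer `k`. -/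
def IsHaarUnitary {A : Type*} [Ring A] [Algebra ℂ A] [StarRing A] (τ : A →ₗ[ℂ] ℂ)
    (u : unitary A) : Prop :=
  ∀ k : ℤ, k ≠ 0 → τ ((u ^ k : unitary A) : A) = 0

/-- A family of unital *-subalgebras `S i` is free for `τ` if `τ (a₁ ⋯ aₙ) = 0` whenever `n ≥ 1`,
`aⱼ ∈ S (iⱼ)`, `τ aⱼ = 0` for all `j`, and consecutive indices `iⱼ`, `iⱼ₊₁` are distinct. -/
def AreFree {A : Type*} [Ring A] [Algebra ℂ A] [StarRing A] [StarModule ℂ A] (τ : A →ₗ[ℂ] ℂ)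
    {ι : Type*} (S : ι → StarSubalgebra ℂ A) : Prop :=
  ∀ l : List (ι × A), l ≠ [] → (l.map Prod.fst).IsChain (· ≠ ·) →
    (∀ p ∈ l, p.2 ∈ S p.1 ∧ τ p.2 = 0) → τ (l.map Prod.snd).prod = 0

/-- Free Haar unitaries: each `u i` is a Haar unitary, and the *-algebras generated by the `u i`
are free. -/
def AreFreeHaarUnitaries {A : Type*} [Ring A] [Algebra ℂ A] [StarRing A] [StarModule ℂ A]
    (τ : A →ₗ[ℂ] ℂ) {ι : Type*} (u : ι → unitary A) : Prop :=
  (∀ i, IsHaarUnitary τ (u i)) ∧ AreFree τ fun i ↦ StarAlgebra.adjoin ℂ {(u i : A)}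

end

/-! Let `U` be the unitary representation of the free group F on N generators defined by the `u i`,
and put φ(g) = |τ(U g)|². The operators π(g) = U g ⊗ ((U g)^op)* again represent F, and the product
functional Φ = τ ⊗ τ^op satisfies Φ(π(g)) = φ(g). The operator in the theorem is T = π(L), where L =
`letterSum` is the sum of the generators and their inverses. A centred element of the *-algebra of a
Haar unitary is a combination of its nonzero powers, so free Haar unitaries are exactly those for
which τ(U g) = 0 for every g ≠ 1 (`areFreeHaarUnitaries_iff`), that is, for which φ is the regular
character.

If φ is the regular character, the moments Φ(Tⁿ) count closed words of length n, and there are at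
most (2√(2N-1))ⁿ of them (`coeff_letterSum_pow_one_le`). Since Φ is bounded, positive and faithful
on the operators that commute with M' ⊗ 1 and 1 ⊗ (M^op)', moments control the norm
(`IsSelfAdjoint.norm_le_of_moments`). Using this class of operators makes slice maps sufficient,
with no commutation theorem for tensor products.

The lower bound and the converse come from `FreeGroup.kesten`, a rigidity form of Kesten's theorem
for nonnegative characters φ. Work on F × F with the character δ₁(g)φ(h): on the diagonal it is
regular, and it is dominated by φ of the second coordinate. All coefficients of A = (1 + L)^k on the
ball of radius k are at least 1, so in the diagonal copy of A one may replace (x, x) by (1, x)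
without creating negative coefficients and without changing the second projection. The moments of
the modified element, hence its quadratic form, stay bounded in terms of ρ = ‖T‖. On a vector f of
the regular representation the change adds φ(x)‖f‖² - ⟨f, x f⟩. Averaging over many ping-pong
conjugates x of a fixed v ≠ 1 makes the subtracted term negligible, while φ(x) = φ(v). If f is
almost extremal for L and ρ = 2√(2N-1), there is no room for a positive gain, so φ(v) = 0. -/

namespace FreeGroup

/-! ### Word length and first letters in free groups -/

variable {α : Type*} [DecidableEq α]

theorem toWord_mk_singleton_mul (s : α × Bool) (g : FreeGroup α)
    (h : g ∉ startsWith (s.1, !s.2)) : (mk [s] * g).toWord = s :: g.toWord := by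
  rw [toWord_mul, toWord_mk, reduce_singleton, List.singleton_append, reduce.cons, reduce_toWord]
  simp only [startsWith, Set.mem_ofPred_eq] at h
  rcases hw : g.toWord with _ | ⟨t, l⟩
  · rfl
  · rw [hw] at h
    have : ¬ (s.1 = t.1 ∧ s.2 = !t.2) := by
      rintro ⟨h1, h2⟩
      apply h
      simp [h1, h2]
    simp [this]

theorem norm_mk_singleton_mul (s : α × Bool) (g : FreeGroup α)
    (h : g ∉ startsWith (s.1, !s.2)) : (mk [s] * g).norm = g.norm + 1 := by
  rw [norm, toWord_mk_singleton_mul s g h, List.length_cons, norm]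

theorem mk_singleton_inv (s : α × Bool) : (mk [s])⁻¹ = mk [(s.1, !s.2)] := by
  simp [inv_mk, invRev]

/-- Multiplication by `s` deletes the first letter of `g`; the remaining tail cannot begin with `s`,
because the word of `g` is reduced. -/
theorem notMem_startsWith_mk_singleton_mul {s : α × Bool} {g : FreeGroup α}
    (h : g ∈ startsWith (s.1, !s.2)) : mk [s] * g ∉ startsWith s := by
  intro hs
  have h1 : mk [s] * g ∉ startsWith ((s.1, !s.2).1, !(s.1, !s.2).2) → _ :=
    toWord_mk_singleton_mul (s.1, !s.2) (mk [s] * g)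
  rw [← mk_singleton_inv, inv_mul_cancel_left] at h1
  simp only [startsWith, Set.mem_ofPred_eq] at h hs
  rcases hw : g.toWord with _ | ⟨t, l⟩
  · simp [hw] at h
  · have ht : t = (s.1, !s.2) := by simpa [hw] using h
    subst ht
    have hl : (mk [s] * g).toWord = l := by
      rw [toWord_mul, toWord_mk, reduce_singleton, List.singleton_append, reduce.cons,
        reduce_toWord, hw]
      simp
    have hred : IsReduced g.toWord := isReduced_toWord
    rw [hw] at hred
    rw [hl] at hs
    rcases l with _ | ⟨t, l⟩
    · simp at hs
    · have ht : t = s := by simpa using hs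
      subst ht
      rw [isReduced_cons_cons] at hred
      simpa using hred.1 rfl

theorem norm_mk_singleton_mul_of_mem {s : α × Bool} {g : FreeGroup α}
    (h : g ∈ startsWith (s.1, !s.2)) : (mk [s] * g).norm + 1 = g.norm := by
  have h1 := norm_mk_singleton_mul (s.1, !s.2) (mk [s] * g)
    (by simpa using notMem_startsWith_mk_singleton_mul h)
  rw [← mk_singleton_inv, inv_mul_cancel_left] at h1
  exact h1.symm

/-- There is no cancellation where `v` meets `g`, so prepending the letters of `v` one at a time
from the right never cancels. -/
theorem mul_mem_startsWith {v g : FreeGroup α} {s : α × Bool} (hv : v ∈ startsWith s)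
    (h : ∀ t ∈ v.toWord.getLast?, g ∉ startsWith (t.1, !t.2)) : v * g ∈ startsWith s := by
  suffices H : ∀ l : List (α × Bool), IsReduced l → ∀ s ∈ l.head?,
      (∀ t ∈ l.getLast?, g ∉ startsWith (t.1, !t.2)) → mk l * g ∈ startsWith s by
    have := H v.toWord isReduced_toWord s (by simpa [startsWith, List.head?_eq_getElem?] using hv) h
    rwa [mk_toWord] at this
  intro l
  induction l with
  | nil => simp
  | cons a l ih =>
    intro hl s hs hg
    obtain rfl : a = s := by simpa using hs
    have hmul : mk (a :: l) * g = mk [a] * (mk l * g) := by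
      rw [← mul_assoc, mul_mk, List.singleton_append]
    rw [hmul]
    apply startsWith_mk_mul
    rcases l with _ | ⟨b, l⟩
    · rw [← one_eq_mk, one_mul]
      exact hg a (by simp)
    · rw [isReduced_cons_cons] at hl
      have hb := ih hl.2 b (by simp) (by simpa using hg)
      intro hc
      have : b = (a.1, !a.2) := by
        by_contra hne
        exact (Set.disjoint_left.1 (startsWith.disjoint_iff_ne.2 hne)) hb hc
      have h2 := hl.1 (by rw [this])
      rw [this] at h2
      simp at h2

/-- The Cayley graph is a regular tree: away from the root, exactly one neighbour, the one with the
first letter deleted, is closer to the root. -/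
theorem sum_norm_mk_singleton_mul [Fintype α] (F : ℕ → ℝ) {g : FreeGroup α} (hg : g ≠ 1) :
    ∑ s : α × Bool, F (mk [s] * g).norm =
      (2 * Fintype.card α - 1) * F (g.norm + 1) + F (g.norm - 1) := by
  obtain ⟨t, l, hw⟩ : ∃ t l, g.toWord = t :: l := by
    rcases hw : g.toWord with _ | ⟨t, l⟩
    · exact absurd (toWord_eq_nil_iff.1 hw) hg
    · exact ⟨t, l, rfl⟩
  have hmem : ∀ s : α × Bool, g ∈ startsWith (s.1, !s.2) ↔ s = (t.1, !t.2) := by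
    intro s
    simp only [startsWith, Set.mem_ofPred_eq, hw, List.getElem?_cons_zero, Option.some.injEq]
    constructor
    · rintro rfl; simp
    · rintro rfl; simp
  rw [← Finset.add_sum_erase _ _ (Finset.mem_univ (t.1, !t.2))]
  have h1 : (mk [(t.1, !t.2)] * g).norm = g.norm - 1 := by
    have := norm_mk_singleton_mul_of_mem ((hmem (t.1, !t.2)).2 rfl)
    omega
  rw [h1, Finset.sum_congr rfl (g := fun _ ↦ F (g.norm + 1))]
  · rw [Finset.sum_const, Finset.card_erase_of_mem (Finset.mem_univ _), Finset.card_univ,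
      Fintype.card_prod, Fintype.card_bool, nsmul_eq_mul, Nat.cast_sub]
    · push_cast; ring
    · have : 0 < Fintype.card α := Fintype.card_pos_iff.2 ⟨t.1⟩
      omega
  · intro s hs
    rw [norm_mk_singleton_mul s g]
    rw [hmem]
    exact Finset.ne_of_mem_erase hs

theorem sum_norm_mk_singleton [Fintype α] (F : ℕ → ℝ) :
    ∑ s : α × Bool, F (mk [s] * (1 : FreeGroup α)).norm = 2 * Fintype.card α * F 1 := by
  have : ∀ s : α × Bool, F (mk [s] * (1 : FreeGroup α)).norm = F 1 := by
    intro s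
    rw [norm_mk_singleton_mul s 1 (by simp [startsWith]), norm_one]
  rw [Finset.sum_congr rfl fun s _ ↦ this s]
  simp [mul_comm]

theorem finite_norm_le [Finite α] (n : ℕ) : {g : FreeGroup α | g.norm ≤ n}.Finite := by
  refine Set.Finite.of_finite_image (f := toWord) ((List.finite_length_le (α × Bool) n).subset ?_)
    toWord_injective.injOn
  rintro _ ⟨g, hg, rfl⟩
  exact hg

end FreeGroup

/-! ### Positive elements and forms on group algebras -/

namespace LinearMap.BilinForm

variable {V : Type*} [AddCommGroup V] [Module ℝ V]

/-- A symmetric operator for a positive form is bounded on `y` by the growth rate of the moments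
of `y`. -/
theorem apply_le_of_pow_le (b : LinearMap.BilinForm ℝ V) (hb : ∀ x, 0 ≤ b x x) (hs : b.IsSymm)
    (A : Module.End ℝ V) (hA : ∀ x y, b (A x) y = b x (A y)) (y : V) {C K : ℝ} (hK : 0 < K)
    (h : ∀ n, b y ((A ^ n) y) ≤ C * K ^ n) : b y (A y) ≤ K * b y y := by
  have hpow : ∀ n x z, b ((A ^ n) x) z = b x ((A ^ n) z) := by
    intro n
    induction n with
    | zero => simp
    | succ n ih =>
      intro x z
      rw [pow_succ, Module.End.mul_apply, ih, hA, ← Module.End.mul_apply, ← pow_succ', pow_succ]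
  -- Cauchy–Schwarz for `y` and `A ^ m y`, with symmetry moving one power across.
  have hcs : ∀ m, (b y ((A ^ m) y)) ^ 2 ≤ b y y * b y ((A ^ (2 * m)) y) := by
    intro m
    have := apply_sq_le_of_symm b hb ⟨fun x y ↦ hs.eq x y⟩ y ((A ^ m) y)
    rwa [hpow, ← Module.End.mul_apply, ← pow_add, ← two_mul] at this
  by_contra! hlt
  have hy : 0 < b y y := by
    refine lt_of_le_of_ne (hb y) fun h0 ↦ ?_
    have h1 := hcs 1
    rw [← h0, zero_mul, pow_one] at h1
    have h2 : b y (A y) = 0 := by nlinarith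
    rw [← h0, h2, mul_zero] at hlt
    exact lt_irrefl _ hlt
  set a := b y (A y) / b y y with ha
  have haK : K < a := by rw [ha, lt_div_iff₀ hy]; exact hlt
  have ha0 : 0 < a := hK.trans haK
  -- Cauchy–Schwarz squares the normalised moment whenever the exponent doubles, so along powers of
  -- two the moments grow at least like those of the ratio `a`; if `a > K` this beats `C * K ^ n`.
  have hgrow : ∀ j : ℕ, a ^ 2 ^ j * b y y ≤ b y ((A ^ 2 ^ j) y) := by
    intro j
    induction j with
    | zero => simp [ha, hy.ne']
    | succ j ih =>
      have h1 : (a ^ 2 ^ j * b y y) ^ 2 ≤ b y y * b y ((A ^ (2 * 2 ^ j)) y) :=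
        le_trans (pow_le_pow_left₀ (by positivity) ih 2) (hcs _)
      rw [pow_succ' 2 j]
      have h2 : (a ^ 2 ^ j * b y y) ^ 2 = b y y * (a ^ (2 * 2 ^ j) * b y y) := by ring
      rw [h2] at h1
      exact le_of_mul_le_mul_left h1 hy
  have hbound : ∀ j : ℕ, (a / K) ^ 2 ^ j ≤ C / b y y := by
    intro j
    rw [div_pow, div_le_div_iff₀ (by positivity) hy]
    exact (hgrow j).trans (h _)
  obtain ⟨n, hn⟩ := pow_unbounded_of_one_lt (C / b y y) (show 1 < a / K by rwa [one_lt_div hK])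
  have h3 : (a / K) ^ n ≤ (a / K) ^ 2 ^ n :=
    pow_le_pow_right₀ (by rw [one_le_div hK]; exact haK.le) Nat.lt_two_pow_self.le
  linarith [hbound n]

end LinearMap.BilinForm

namespace MonoidAlgebra

variable {Γ : Type*} [Group Γ]

/-- All coefficients are nonnegative. -/
def IsNonneg (P : MonoidAlgebra ℝ Γ) : Prop := ∀ g, 0 ≤ P.coeff g

theorem IsNonneg.add {P Q : MonoidAlgebra ℝ Γ} (hP : P.IsNonneg) (hQ : Q.IsNonneg) :
    (P + Q).IsNonneg := fun g ↦ by
  rw [coeff_add, Finsupp.add_apply]; exact add_nonneg (hP g) (hQ g)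

theorem IsNonneg.smul {P : MonoidAlgebra ℝ Γ} (hP : P.IsNonneg) {c : ℝ} (hc : 0 ≤ c) :
    (c • P).IsNonneg := fun g ↦ by
  rw [coeff_smul_apply]; exact mul_nonneg hc (hP g)

theorem IsNonneg.mul {P Q : MonoidAlgebra ℝ Γ} (hP : P.IsNonneg) (hQ : Q.IsNonneg) :
    (P * Q).IsNonneg := fun g ↦ by
  rw [coeff_mul_apply_left]
  exact Finsupp.sum_nonneg fun h _ ↦ mul_nonneg (hP h) (hQ _)

theorem isNonneg_single (g : Γ) {c : ℝ} (hc : 0 ≤ c) : (single g c).IsNonneg := fun h ↦ by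
  classical
  rw [coeff_single, Finsupp.single_apply]
  split_ifs <;> simp [hc]

theorem isNonneg_one : (1 : MonoidAlgebra ℝ Γ).IsNonneg := isNonneg_single 1 zero_le_one

theorem IsNonneg.sum {ι : Type*} {s : Finset ι} {P : ι → MonoidAlgebra ℝ Γ}
    (h : ∀ i ∈ s, (P i).IsNonneg) : (∑ i ∈ s, P i).IsNonneg := fun g ↦ by
  rw [coeff_sum, Finsupp.finsetSum_apply]
  exact Finset.sum_nonneg fun i hi ↦ h i hi g

theorem IsNonneg.pow {P : MonoidAlgebra ℝ Γ} (hP : P.IsNonneg) (n : ℕ) : (P ^ n).IsNonneg := by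
  induction n with
  | zero => simpa using isNonneg_one
  | succ n ih => rw [pow_succ]; exact ih.mul hP

theorem IsNonneg.mapDomainAlgHom {Γ' : Type*} [Group Γ'] {P : MonoidAlgebra ℝ Γ}
    (hP : P.IsNonneg) (f : Γ →* Γ') : (mapDomainAlgHom ℝ ℝ f P).IsNonneg := by
  have h : P = P.coeff.sum single := (sum_coeff_single P).symm
  rw [h, Finsupp.sum, map_sum]
  refine IsNonneg.sum fun g _ ↦ ?_
  rw [mapDomainAlgHom_apply, mapDomain_single]
  exact isNonneg_single _ (hP g)

/-- The linear functional on the group algebra that extends a function on the group. -/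
noncomputable def eval (φ : Γ → ℝ) : MonoidAlgebra ℝ Γ →ₗ[ℝ] ℝ :=
  Finsupp.linearCombination ℝ φ ∘ₗ (coeffLinearEquiv ℝ).toLinearMap

@[simp] theorem eval_single (φ : Γ → ℝ) (g : Γ) (a : ℝ) : eval φ (single g a) = a * φ g := by
  simp [eval, coeffLinearEquiv]

theorem eval_apply (φ : Γ → ℝ) (P : MonoidAlgebra ℝ Γ) :
    eval φ P = P.coeff.sum fun g a ↦ a * φ g := rfl

/-- The form on the group algebra with `⟨g, h⟩ = φ (g⁻¹ h)`. -/
noncomputable def form (φ : Γ → ℝ) : LinearMap.BilinForm ℝ (MonoidAlgebra ℝ Γ) :=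
  Finsupp.linearCombination ℝ (fun g ↦ eval fun h ↦ φ (g⁻¹ * h)) ∘ₗ
    (coeffLinearEquiv ℝ).toLinearMap

theorem form_apply (φ : Γ → ℝ) (P Q : MonoidAlgebra ℝ Γ) :
    form φ P Q = P.coeff.sum fun g a ↦ Q.coeff.sum fun h b ↦ a * (b * φ (g⁻¹ * h)) := by
  simp only [form, LinearMap.comp_apply, Finsupp.linearCombination_apply, Finsupp.sum,
    LinearMap.sum_apply, LinearMap.smul_apply, smul_eq_mul, eval_apply, Finset.mul_sum]
  rfl

@[simp] theorem form_single_single (φ : Γ → ℝ) (g h : Γ) (a b : ℝ) :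
    form φ (single g a) (single h b) = a * (b * φ (g⁻¹ * h)) := by
  simp [form_apply]

theorem bilinForm_ext_single {V : Type*} [AddCommMonoid V] [Module ℝ V]
    {B B' : MonoidAlgebra ℝ Γ →ₗ[ℝ] MonoidAlgebra ℝ Γ →ₗ[ℝ] V}
    (h : ∀ g g' a b, B (single g a) (single g' b) = B' (single g a) (single g' b)) : B = B' := by
  refine LinearMap.ext₂ fun P Q ↦ ?_
  induction P using induction_linear with
  | zero => simp
  | add x y hx hy => simp [hx, hy]
  | single g a =>
    induction Q using induction_linear with
    | zero => simp
    | add x y hx hy => simp only [map_add, hx, hy]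
    | single g' b => exact h g g' a b

/-- Positive definite functions on a group. -/
def IsPosDefFun (φ : Γ → ℝ) : Prop := (Matrix.of fun g h : Γ ↦ φ (g⁻¹ * h)).PosSemidef

theorem IsPosDefFun.inv {φ : Γ → ℝ} (hφ : IsPosDefFun φ) (g : Γ) : φ g⁻¹ = φ g := by
  have := hφ.1.apply 1 g
  simpa using this

theorem IsPosDefFun.form_self_nonneg {φ : Γ → ℝ} (hφ : IsPosDefFun φ) (P : MonoidAlgebra ℝ Γ) :
    0 ≤ form φ P P := by
  rw [form_apply]
  refine (hφ.2 P.coeff).trans_eq ?_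
  refine Finsupp.sum_congr fun g _ ↦ Finsupp.sum_congr fun h _ ↦ ?_
  simp only [star_trivial, Matrix.of_apply]
  ring

theorem IsPosDefFun.form_isSymm {φ : Γ → ℝ} (hφ : IsPosDefFun φ) : (form φ).IsSymm := by
  constructor
  intro P Q
  have : form φ = (form φ).flip := by
    refine bilinForm_ext_single fun g g' a b ↦ ?_
    change _ = form φ _ _
    rw [form_single_single, form_single_single, ← hφ.inv (g⁻¹ * g')]
    rw [mul_inv_rev, inv_inv]
    ring
  exact congrArg (fun B ↦ B P Q) this

/-- Both sides evaluate φ at (x g)⁻¹ h = g⁻¹ (x⁻¹ h): left translation by `x` has adjoint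
translation by `x⁻¹`. -/
theorem form_single_mul_left (φ : Γ → ℝ) (x : Γ) (c : ℝ) (P Q : MonoidAlgebra ℝ Γ) :
    form φ (single x c * P) Q = form φ P (single x⁻¹ c * Q) := by
  have : (form φ).comp (LinearMap.mulLeft ℝ (single x c)) LinearMap.id =
      (form φ).comp LinearMap.id (LinearMap.mulLeft ℝ (single x⁻¹ c)) := by
    refine bilinForm_ext_single fun g g' a b ↦ ?_
    simp only [LinearMap.BilinForm.comp_apply, LinearMap.mulLeft_apply, LinearMap.id_apply,
      single_mul_single, form_single_single, mul_inv_rev, mul_assoc]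
    ring
  exact congrArg (fun B ↦ B P Q) this

/-- An element of the group algebra is symmetric if it is its own adjoint. -/
def IsSymmetric (B : MonoidAlgebra ℝ Γ) : Prop :=
  ∀ (φ : Γ → ℝ) (P Q : MonoidAlgebra ℝ Γ), form φ (B * P) Q = form φ P (B * Q)

theorem IsSymmetric.add {A B : MonoidAlgebra ℝ Γ} (hA : A.IsSymmetric) (hB : B.IsSymmetric) :
    (A + B).IsSymmetric := fun φ P Q ↦ by
  simp only [add_mul, map_add, LinearMap.add_apply, hA φ P Q, hB φ P Q]

theorem IsSymmetric.smul {A : MonoidAlgebra ℝ Γ} (hA : A.IsSymmetric) (c : ℝ) :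
    (c • A).IsSymmetric := fun φ P Q ↦ by
  simp only [smul_mul_assoc, map_smul, LinearMap.smul_apply, hA φ P Q]

theorem IsSymmetric.sub {A B : MonoidAlgebra ℝ Γ} (hA : A.IsSymmetric) (hB : B.IsSymmetric) :
    (A - B).IsSymmetric := fun φ P Q ↦ by
  simp only [sub_mul, map_sub, LinearMap.sub_apply, hA φ P Q, hB φ P Q]

theorem isSymmetric_one : (1 : MonoidAlgebra ℝ Γ).IsSymmetric := fun φ P Q ↦ by simp

theorem IsSymmetric.sum {ι : Type*} {s : Finset ι} {A : ι → MonoidAlgebra ℝ Γ}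
    (h : ∀ i ∈ s, (A i).IsSymmetric) : (∑ i ∈ s, A i).IsSymmetric := fun φ P Q ↦ by
  simp only [Finset.sum_mul, map_sum, LinearMap.sum_apply]
  exact Finset.sum_congr rfl fun i hi ↦ h i hi φ P Q

theorem IsSymmetric.pow {A : MonoidAlgebra ℝ Γ} (hA : A.IsSymmetric) (n : ℕ) :
    (A ^ n).IsSymmetric := by
  induction n with
  | zero => simpa using isSymmetric_one
  | succ n ih =>
    intro φ P Q
    rw [pow_succ, mul_assoc, ih, hA, ← mul_assoc, ← pow_succ', ← pow_succ]

theorem isSymmetric_single_add_single_inv (x : Γ) (c : ℝ) :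
    (single x c + single x⁻¹ c).IsSymmetric := fun φ P Q ↦ by
  simp only [add_mul, map_add, LinearMap.add_apply, form_single_mul_left, inv_inv]
  ring

theorem IsSymmetric.form_le_of_pow_le {φ : Γ → ℝ} (hφ : IsPosDefFun φ) {B : MonoidAlgebra ℝ Γ}
    (hB : B.IsSymmetric) (y : MonoidAlgebra ℝ Γ) {C K : ℝ} (hK : 0 < K)
    (h : ∀ n, form φ y (B ^ n * y) ≤ C * K ^ n) : form φ y (B * y) ≤ K * form φ y y := by
  have hpow : ∀ n, (LinearMap.mulLeft ℝ B ^ n) y = B ^ n * y := by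
    intro n
    rw [LinearMap.pow_mulLeft, LinearMap.mulLeft_apply]
  refine LinearMap.BilinForm.apply_le_of_pow_le (form φ) hφ.form_self_nonneg hφ.form_isSymm
    (LinearMap.mulLeft ℝ B) (hB φ) y (C := C) hK fun n ↦ ?_
  rw [hpow]
  exact h n

/-- Nonnegative coefficients turn a pointwise comparison of functions on the group into a comparison
of moments. This is why nonnegativity is tracked throughout. -/
theorem form_mono {φ ψ : Γ → ℝ} (h : ∀ g, φ g ≤ ψ g) {P Q : MonoidAlgebra ℝ Γ}
    (hP : P.IsNonneg) (hQ : Q.IsNonneg) : form φ P Q ≤ form ψ P Q := by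
  rw [form_apply, form_apply]
  exact Finset.sum_le_sum fun g _ ↦ Finset.sum_le_sum fun g' _ ↦
    mul_le_mul_of_nonneg_left (mul_le_mul_of_nonneg_left (h _) (hQ g')) (hP g)

theorem form_mono_right {φ : Γ → ℝ} (h : ∀ g, 0 ≤ φ g) {P Q R : MonoidAlgebra ℝ Γ}
    (hP : P.IsNonneg) (hQR : (R - Q).IsNonneg) : form φ P Q ≤ form φ P R := by
  have h0 : 0 ≤ form φ P (R - Q) := by
    rw [form_apply]
    exact Finset.sum_nonneg fun g _ ↦ Finset.sum_nonneg fun g' _ ↦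
      mul_nonneg (hP g) (mul_nonneg (hQR g') (h _))
  rw [map_sub] at h0
  linarith

theorem form_mapDomainAlgHom {Γ' : Type*} [Group Γ'] (f : Γ →* Γ') (φ : Γ' → ℝ)
    (P Q : MonoidAlgebra ℝ Γ) :
    form φ (mapDomainAlgHom ℝ ℝ f P) (mapDomainAlgHom ℝ ℝ f Q) = form (φ ∘ f) P Q := by
  have : (form φ).compl₁₂ (mapDomainAlgHom ℝ ℝ f).toLinearMap (mapDomainAlgHom ℝ ℝ f).toLinearMap =
      form (φ ∘ f) := by
    refine bilinForm_ext_single fun g g' a b ↦ ?_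
    simp
  exact congrArg (fun B ↦ B P Q) this

open Classical in
/-- The character of the regular representation. -/
noncomputable def regularChar (Γ : Type*) [Group Γ] : Γ → ℝ := fun g ↦ if g = 1 then 1 else 0

theorem form_regularChar (P Q : MonoidAlgebra ℝ Γ) :
    form (regularChar Γ) P Q = ∑ g ∈ P.coeff.support, P.coeff g * Q.coeff g := by
  classical
  rw [form_apply, Finsupp.sum]
  refine Finset.sum_congr rfl fun g _ ↦ ?_
  rw [Finsupp.sum, ← Finset.mul_sum]
  congr 1
  simp only [regularChar, inv_mul_eq_one, mul_ite, mul_one, mul_zero, Finset.sum_ite_eq]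
  split_ifs with h
  · rfl
  · exact (Finsupp.notMem_support_iff.1 h).symm

theorem isPosDefFun_regularChar : IsPosDefFun (regularChar Γ) := by
  classical
  have : (Matrix.of fun g h : Γ ↦ regularChar Γ (g⁻¹ * h)) = 1 := by
    ext g h
    simp [regularChar, inv_mul_eq_one, Matrix.one_apply]
  rw [IsPosDefFun, this]
  exact Matrix.PosSemidef.one

/-- The Schur product theorem. -/
theorem IsPosDefFun.mul {φ ψ : Γ → ℝ} (hφ : IsPosDefFun φ) (hψ : IsPosDefFun ψ) :
    IsPosDefFun fun g ↦ φ g * ψ g :=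
  Matrix.PosSemidef.hadamard hφ hψ

theorem IsPosDefFun.comp {Γ' : Type*} [Group Γ'] {φ : Γ → ℝ} (hφ : IsPosDefFun φ) (f : Γ' →* Γ) :
    IsPosDefFun fun g ↦ φ (f g) := by
  have := Matrix.PosSemidef.submatrix hφ f
  refine (congrArg Matrix.PosSemidef ?_).mp this
  ext g h
  simp

end MonoidAlgebra

/-! ### The adjacency operator of a free group -/

namespace FreeGroup

open MonoidAlgebra

variable {α : Type*} [Fintype α]

/-- The sum of the free generators and their inverses in the group algebra. -/
noncomputable def letterSum (α : Type*) [Fintype α] : MonoidAlgebra ℝ (FreeGroup α) :=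
  ∑ s : α × Bool, single (mk [s]) 1

/-- Inversion of letters. -/
def letterInv (α : Type*) : α × Bool ≃ α × Bool where
  toFun s := (s.1, !s.2)
  invFun s := (s.1, !s.2)
  left_inv s := by simp
  right_inv s := by simp

theorem coeff_letterSum_mul (f : MonoidAlgebra ℝ (FreeGroup α)) (g : FreeGroup α) :
    (letterSum α * f).coeff g = ∑ s : α × Bool, f.coeff (mk [s] * g) := by
  rw [letterSum, Finset.sum_mul, coeff_sum, Finsupp.finsetSum_apply, ← (letterInv α).sum_comp]
  refine Finset.sum_congr rfl fun s _ ↦ ?_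
  rw [coeff_single_mul_apply, one_mul]
  congr 2
  simp [letterInv, inv_mk, invRev]

theorem isNonneg_letterSum : (letterSum α).IsNonneg :=
  IsNonneg.sum fun _ _ ↦ isNonneg_single _ zero_le_one

theorem isNonneg_one_add_letterSum_pow (n : ℕ) : ((1 + letterSum α) ^ n).IsNonneg :=
  (isNonneg_one.add isNonneg_letterSum).pow n

variable [DecidableEq α]

/-- The number of closed words in the letters of a free group. -/
theorem coeff_letterSum_pow_one_le (hα : 1 ≤ Fintype.card α) (n : ℕ) :
    (letterSum α ^ n).coeff 1 ≤ (2 * √(2 * Fintype.card α - 1)) ^ n := by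
  set q : ℝ := 2 * Fintype.card α - 1 with hq
  have hq1 : 1 ≤ q := by
    have : (1 : ℝ) ≤ Fintype.card α := by exact_mod_cast hα
    linarith
  set w := √q with hw
  have hww : w * w = q := Real.mul_self_sqrt (by linarith)
  have hw0 : 0 < w := Real.sqrt_pos.2 (by linarith)
  -- The induction needs a bound at every `g`. The radial weight w^(-|g|) works: off the root q
  -- w^(-k-2) + w^(-k) = 2w · w^(-k-1) because w² = q, and at the root (q + 1)/w ≤ 2w because q ≥ 1.
  have key : ∀ n g, (letterSum α ^ n).coeff g ≤ (2 * w) ^ n * (w⁻¹) ^ g.norm := by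
    intro n
    induction n with
    | zero =>
      intro g
      rw [pow_zero, pow_zero, one_mul, one_def, coeff_single, Finsupp.single_apply]
      split_ifs with h
      · rw [← h]; simp
      · positivity
    | succ n ih =>
      intro g
      rw [pow_succ', coeff_letterSum_mul]
      refine (Finset.sum_le_sum fun s _ ↦ ih (mk [s] * g)).trans ?_
      rw [← Finset.mul_sum, pow_succ, mul_assoc]
      refine mul_le_mul_of_nonneg_left ?_ (by positivity)
      by_cases hg : g = 1
      · subst hg
        rw [sum_norm_mk_singleton (fun k ↦ w⁻¹ ^ k)]
        rw [norm_one, pow_zero, pow_one, mul_one, ← div_eq_mul_inv, div_le_iff₀ hw0, mul_assoc, hww]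
        linarith
      · rw [sum_norm_mk_singleton_mul (fun k ↦ w⁻¹ ^ k) hg, ← hq, ← hww]
        obtain ⟨k, hk⟩ : ∃ k, g.norm = k + 1 :=
          Nat.exists_eq_succ_of_ne_zero (fun h ↦ hg (norm_eq_zero.1 h))
        rw [hk, Nat.add_sub_cancel, pow_succ, pow_succ]
        apply le_of_eq
        field_simp
        ring
  simpa using key n 1

/-- The adjacency operator of a free group has finitely supported nonnegative almost eigenvectors
at the top of its spectrum. -/
theorem exists_letterSum_mul_ge (hα : 1 ≤ Fintype.card α) {κ : ℝ}
    (hκ : κ < 2 * √(2 * Fintype.card α - 1)) :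
    ∃ f : MonoidAlgebra ℝ (FreeGroup α), f.IsNonneg ∧ 0 < form (regularChar _) f f ∧
      (letterSum α * f - κ • f).IsNonneg := by
  set q : ℝ := 2 * Fintype.card α - 1 with hq
  have hq1 : 1 ≤ q := by
    have : (1 : ℝ) ≤ Fintype.card α := by exact_mod_cast hα
    linarith
  set w := √q with hw
  have hww : w * w = q := Real.mul_self_sqrt (by linarith)
  have hw0 : 0 < w := Real.sqrt_pos.2 (by linarith)
  -- 2w cos(π/(R+2)) is the eigenvalue that the radial sine profile below gives on a ball of radius
  -- R; it tends to 2w.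
  obtain ⟨R, hR⟩ : ∃ R : ℕ, κ < 2 * w * Real.cos (Real.pi / (R + 2)) := by
    have h1 : Filter.Tendsto (fun R : ℕ ↦ 2 * w * Real.cos (Real.pi / ((R : ℝ) + 2)))
        Filter.atTop (nhds (2 * w * Real.cos 0)) := by
      refine Filter.Tendsto.const_mul _ ((Real.continuous_cos.tendsto 0).comp ?_)
      exact Filter.Tendsto.const_div_atTop
        (Filter.tendsto_atTop_add_const_right _ _ tendsto_natCast_atTop_atTop) _
    rw [Real.cos_zero, mul_one] at h1
    exact (h1.eventually (lt_mem_nhds hκ)).exists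
  set θ := Real.pi / (R + 2) with hθ
  have hθ0 : 0 < θ := by positivity
  have hθR : θ * (R + 2) = Real.pi := by rw [hθ]; field_simp
  -- The first Dirichlet eigenvector of the path 0, …, R: it vanishes at -1 and at R + 1.
  let a : ℕ → ℝ := fun k ↦ Real.sin (θ * (k + 1))
  have ha_nonneg : ∀ k ≤ R + 1, 0 ≤ a k := by
    intro k hk
    have hk' : (k : ℝ) ≤ R + 1 := by exact_mod_cast hk
    refine Real.sin_nonneg_of_nonneg_of_le_pi (by positivity) ?_
    rw [← hθR]
    exact mul_le_mul_of_nonneg_left (by linarith) hθ0.le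
  have ha_end : a (R + 1) = 0 := by
    simp only [a]
    rw [show θ * (((R + 1 : ℕ) : ℝ) + 1) = Real.pi by rw [← hθR]; push_cast; ring]
    exact Real.sin_pi
  have ha_rec : ∀ k, a (k + 2) + a k = 2 * Real.cos θ * a (k + 1) := by
    intro k
    simp only [a]
    push_cast
    rw [show θ * ((k : ℝ) + 2 + 1) = θ * (k + 1 + 1) + θ by ring,
      show θ * ((k : ℝ) + 1) = θ * (k + 1 + 1) - θ by ring, Real.sin_add, Real.sin_sub]
    ring
  have ha_one : a 1 = 2 * Real.cos θ * a 0 := by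
    simp only [a]
    push_cast
    rw [show θ * ((1 : ℝ) + 1) = 2 * θ by ring, show θ * ((0 : ℝ) + 1) = θ by ring, Real.sin_two_mul]
    ring
  let F : ℕ → ℝ := fun k ↦ if k ≤ R then w⁻¹ ^ k * a k else 0
  -- Since a(R + 1) = 0, the closed formula survives one step past the cutoff, so the recurrence can
  -- be used on the boundary sphere.
  have hF : ∀ k ≤ R + 1, F k = w⁻¹ ^ k * a k := by
    intro k hk
    simp only [F]
    split_ifs with h
    · rfl
    · rw [show k = R + 1 by omega, ha_end, mul_zero]
  have hF0 : ∀ k, 0 ≤ F k := by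
    intro k
    simp only [F]
    split_ifs with h
    · exact mul_nonneg (by positivity) (ha_nonneg k (by omega))
    · exact le_rfl
  have hFκ : ∀ k, κ * F k ≤ 2 * w * Real.cos θ * F k := fun k ↦
    mul_le_mul_of_nonneg_right hR.le (hF0 k)
  let f : MonoidAlgebra ℝ (FreeGroup α) :=
    ofCoeff (Finsupp.onFinset (finite_norm_le R).toFinset (fun g ↦ F g.norm) (by
      intro g hg
      simp only [Set.Finite.mem_toFinset, Set.mem_ofPred_eq]
      by_contra h
      exact hg (by simp only [F, if_neg h])))
  have hf : ∀ g, f.coeff g = F g.norm := fun g ↦ rfl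
  have hf0 : f.IsNonneg := fun g ↦ by rw [hf]; exact hF0 _
  refine ⟨f, hf0, ?_, ?_⟩
  · rw [form_regularChar]
    refine Finset.sum_pos' (fun g _ ↦ mul_self_nonneg _) ⟨1, ?_, ?_⟩
    all_goals
      have h1 : 0 < f.coeff 1 := by
        rw [hf, norm_one, hF 0 (by omega), pow_zero, one_mul]
        simp only [a]
        push_cast
        rw [zero_add, mul_one]
        refine Real.sin_pos_of_pos_of_lt_pi hθ0 ?_
        rw [← hθR]
        have : (0 : ℝ) ≤ R := Nat.cast_nonneg R
        nlinarith
    · exact Finsupp.mem_support_iff.2 h1.ne'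
    · exact mul_pos h1 h1
  · intro g
    rw [coeff_sub, Finsupp.sub_apply, coeff_letterSum_mul, coeff_smul_apply, smul_eq_mul, hf,
      sub_nonneg]
    simp only [hf]
    by_cases hgR : g.norm ≤ R
    swap
    · have : F g.norm = 0 := by simp only [F, if_neg hgR]
      rw [this, mul_zero]
      exact Finset.sum_nonneg fun s _ ↦ hF0 _
    refine (hFκ _).trans ?_
    -- The root has q + 1 neighbours further out instead of q. This leaves a nonnegative surplus w⁻¹
    -- a(1), so only an inequality holds there; elsewhere in the ball the eigenvalue relation is
    -- exact.
    by_cases hg : g = 1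
    · subst hg
      rw [sum_norm_mk_singleton F, norm_one, hF 0 (by omega), hF 1 (by omega), ha_one, pow_zero,
        pow_one, one_mul]
      have h0 := ha_nonneg 1 (by omega)
      rw [ha_one] at h0
      have h2 : 2 * (Fintype.card α : ℝ) = w * w + 1 := by rw [hww, hq]; ring
      rw [h2]
      have h3 : (w * w + 1) * (w⁻¹ * (2 * Real.cos θ * a 0)) =
          2 * w * Real.cos θ * a 0 + w⁻¹ * (2 * Real.cos θ * a 0) := by
        field_simp
      rw [h3]
      have : 0 ≤ w⁻¹ * (2 * Real.cos θ * a 0) := mul_nonneg (by positivity) h0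
      linarith
    · rw [sum_norm_mk_singleton_mul F hg, ← hq, ← hww]
      obtain ⟨k, hk⟩ : ∃ k, g.norm = k + 1 :=
        Nat.exists_eq_succ_of_ne_zero (fun h ↦ hg (norm_eq_zero.1 h))
      rw [hk, Nat.add_sub_cancel, hF (k + 1 + 1) (by omega), hF k (by omega), hF (k + 1) (by omega)]
      have h1 := ha_rec k
      rw [show k + 1 + 1 = k + 2 from rfl, show a (k + 2) = 2 * Real.cos θ * a (k + 1) - a k by linarith,
        pow_succ, pow_succ]
      apply le_of_eq
      have hr : w * w⁻¹ = 1 := mul_inv_cancel₀ hw0.ne'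
      linear_combination -(w⁻¹ ^ k * (2 * Real.cos θ * a (k + 1) * (w * w⁻¹) -
        a k * (1 + w * w⁻¹))) * hr

theorem exists_mk_singleton_mul_norm {g : FreeGroup α} (hg : g ≠ 1) :
    ∃ s : α × Bool, (mk [s] * g).norm + 1 = g.norm := by
  rcases hw : g.toWord with _ | ⟨t, l⟩
  · exact absurd (toWord_eq_nil_iff.1 hw) hg
  · refine ⟨(t.1, !t.2), norm_mk_singleton_mul_of_mem ?_⟩
    simp [startsWith, hw]

/-- The summand 1 lets a walk wait, so each element of the ball is reached in exactly `n` steps;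
powers of `letterSum` alone would miss elements of the wrong parity. -/
theorem one_le_coeff_one_add_letterSum_pow (n : ℕ) (g : FreeGroup α) (hg : g.norm ≤ n) :
    1 ≤ ((1 + letterSum α) ^ n).coeff g := by
  induction n generalizing g with
  | zero =>
    have : g = 1 := norm_eq_zero.1 (by omega)
    subst this
    simp [one_def]
  | succ n ih =>
    have hpos := isNonneg_one_add_letterSum_pow (α := α) n
    rw [pow_succ', add_mul, one_mul, coeff_add, Finsupp.add_apply, coeff_letterSum_mul]
    by_cases h : g.norm ≤ n
    · have := Finset.sum_nonneg fun (s : α × Bool) (_ : s ∈ Finset.univ) ↦ hpos (mk [s] * g)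
      linarith [ih g h]
    · obtain ⟨s, hs⟩ := exists_mk_singleton_mul_norm (g := g) (by
        rintro rfl
        simp at h)
      have h1 := ih (mk [s] * g) (by omega)
      have h2 := Finset.single_le_sum (fun (s : α × Bool) (_ : s ∈ Finset.univ) ↦ hpos (mk [s] * g))
        (Finset.mem_univ s)
      linarith [hpos g]

theorem one_add_letterSum_pow_mul_ge {κ : ℝ} (hκ : 0 ≤ κ) {f : MonoidAlgebra ℝ (FreeGroup α)}
    (h : (letterSum α * f - κ • f).IsNonneg) (n : ℕ) :
    ((1 + letterSum α) ^ n * f - (1 + κ) ^ n • f).IsNonneg := by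
  induction n with
  | zero => intro g; simp
  | succ n ih =>
    -- Splitting off one factor writes the new difference as a nonnegative element times the old
    -- hypothesis plus a nonnegative multiple of the previous difference.
    have h1 : (1 + letterSum α) ^ (n + 1) * f - (1 + κ) ^ (n + 1) • f =
        (1 + letterSum α) ^ n * (letterSum α * f - κ • f) +
          (1 + κ) • ((1 + letterSum α) ^ n * f - (1 + κ) ^ n • f) := by
      rw [pow_succ, pow_succ, mul_sub, smul_sub, smul_smul, mul_assoc, add_mul, mul_add, one_mul,
        mul_smul_comm, add_smul, one_smul, mul_comm (1 + κ)]
      abel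
    rw [h1]
    exact ((isNonneg_one_add_letterSum_pow n).mul h).add (ih.smul (by linarith))

end FreeGroup

/-! ### Kesten's theorem for characters of free groups -/

namespace MonoidAlgebra

variable {G : Type*} [Group G]

/-- All the mass of `F` lies on the support of `f`, so summing over a translate of that support can
only lose terms. -/
theorem sum_support_translate_le {f : MonoidAlgebra ℝ G} (F : G → ℝ) (hF : ∀ g, 0 ≤ F g)
    (hf : ∀ g, f.coeff g = 0 → F g = 0) (x : G) :
    ∑ g ∈ f.coeff.support, F (x * g) ≤ ∑ g ∈ f.coeff.support, F g := by
  classical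
  rw [← Finset.sum_image (f := F) (s := f.coeff.support) (g := fun g ↦ x * g)
    (mul_right_injective x).injOn]
  rw [← Finset.sum_inter_add_sum_sdiff (f.coeff.support.image fun g ↦ x * g) f.coeff.support]
  rw [Finset.sum_eq_zero (s := _ \ _), add_zero]
  · exact Finset.sum_le_sum_of_subset_of_nonneg Finset.inter_subset_right fun g _ _ ↦ hF g
  · intro g hg
    exact hf g (Finsupp.notMem_support_iff.1 (Finset.mem_sdiff.1 hg).2)

/-- Ping-pong elements act almost orthogonally in the regular representation. -/
theorem sum_form_regularChar_le {ι : Type*} [Fintype ι] {t : ℝ} (ht : 0 < t)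
    (hι : (Fintype.card ι : ℝ) = t * t) (x : ι → G) (D : ι → Set G)
    (hD : Pairwise fun i j ↦ Disjoint (D i) (D j)) (hx : ∀ i, ∀ h ∉ D i, x i * h ∈ D i)
    (f : MonoidAlgebra ℝ G) :
    ∑ i, form (regularChar G) f (single (x i) 1 * f) ≤ 2 * t * form (regularChar G) f f := by
  classical
  set S := f.coeff.support with hS
  -- The mass of `f` inside `D i`; disjointness makes the total over `i` at most the mass of `f`.
  let e : ι → G → ℝ := fun i g ↦ if g ∈ D i then f.coeff g * f.coeff g else 0
  have he : ∀ i g, 0 ≤ e i g := by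
    intro i g
    simp only [e]
    split_ifs
    · exact mul_self_nonneg _
    · exact le_rfl
  have hsum_e : ∀ g, ∑ i, e i g ≤ f.coeff g * f.coeff g := by
    intro g
    by_cases h : ∃ i, g ∈ D i
    · obtain ⟨i, hi⟩ := h
      rw [Finset.sum_eq_single i]
      · simp [e, hi]
      · intro j _ hj
        have : g ∉ D j := fun hgj ↦ Set.disjoint_left.1 (hD hj) hgj hi
        simp [e, this]
      · simp
    · push Not at h
      rw [Finset.sum_eq_zero fun i _ ↦ by simp [e, h i]]
      exact mul_self_nonneg _
  have hpt : ∀ a b : ℝ, a * b ≤ t / 2 * (a * a) + 1 / (2 * t) * (b * b) := by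
    intro a b
    have : t / 2 * (a * a) + 1 / (2 * t) * (b * b) - a * b = (t * a - b) ^ 2 / (2 * t) := by
      field_simp
      ring
    have h2 : 0 ≤ (t * a - b) ^ 2 / (2 * t) := by positivity
    linarith
  -- At least one of `g` and (x i)⁻¹ g lies in `D i`. The weighted inequality puts the large weight
  -- t/2 on a point in `D i` and the small weight 1/(2t) on the other.
  have hterm : ∀ i g, f.coeff g * f.coeff ((x i)⁻¹ * g) ≤
      t / 2 * e i g + t / 2 * e i ((x i)⁻¹ * g) +
        (1 / (2 * t) * (f.coeff g * f.coeff g) +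
          1 / (2 * t) * (f.coeff ((x i)⁻¹ * g) * f.coeff ((x i)⁻¹ * g))) := by
    intro i g
    have h0 : 0 ≤ 1 / (2 * t) * (f.coeff g * f.coeff g) :=
      mul_nonneg (by positivity) (mul_self_nonneg _)
    have h0' : 0 ≤ 1 / (2 * t) * (f.coeff ((x i)⁻¹ * g) * f.coeff ((x i)⁻¹ * g)) :=
      mul_nonneg (by positivity) (mul_self_nonneg _)
    have h1 : 0 ≤ t / 2 * e i g := mul_nonneg (by positivity) (he _ _)
    have h1' : 0 ≤ t / 2 * e i ((x i)⁻¹ * g) := mul_nonneg (by positivity) (he _ _)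
    by_cases hg : g ∈ D i
    · have h2 : e i g = f.coeff g * f.coeff g := by simp [e, hg]
      have := hpt (f.coeff g) (f.coeff ((x i)⁻¹ * g))
      rw [← h2] at this
      linarith
    · have hg' : (x i)⁻¹ * g ∈ D i := by
        by_contra h
        exact hg (by simpa using hx i _ h)
      have h2 : e i ((x i)⁻¹ * g) = f.coeff ((x i)⁻¹ * g) * f.coeff ((x i)⁻¹ * g) := by
        simp [e, hg']
      have := hpt (f.coeff ((x i)⁻¹ * g)) (f.coeff g)
      rw [← h2] at this
      linarith
  have hI : ∀ i, form (regularChar G) f (single (x i) 1 * f) ≤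
      t * ∑ g ∈ S, e i g + 1 / t * ∑ g ∈ S, f.coeff g * f.coeff g := by
    intro i
    rw [form_regularChar]
    simp only [coeff_single_mul_apply, one_mul]
    refine (Finset.sum_le_sum fun g _ ↦ hterm i g).trans ?_
    rw [Finset.sum_add_distrib, Finset.sum_add_distrib, Finset.sum_add_distrib, ← Finset.mul_sum,
      ← Finset.mul_sum, ← Finset.mul_sum, ← Finset.mul_sum]
    have h1 := sum_support_translate_le (f := f) (e i) (he i)
      (fun g hg ↦ by simp [e, hg]) (x i)⁻¹
    have h2 := sum_support_translate_le (f := f) (fun g ↦ f.coeff g * f.coeff g)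
      (fun g ↦ mul_self_nonneg _) (fun g hg ↦ by simp [hg]) (x i)⁻¹
    have h3 := mul_le_mul_of_nonneg_left h1 (show 0 ≤ t / 2 by positivity)
    have h4 := mul_le_mul_of_nonneg_left h2 (show 0 ≤ 1 / (2 * t) by positivity)
    have h5 : 1 / t * ∑ g ∈ S, f.coeff g * f.coeff g =
        1 / (2 * t) * (∑ g ∈ S, f.coeff g * f.coeff g) +
          1 / (2 * t) * (∑ g ∈ S, f.coeff g * f.coeff g) := by
      field_simp
      ring
    rw [h5]
    linarith
  -- Over t² indices the first terms add up to at most t‖f‖², by disjointness, and the second to t²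
  -- · (1/t)‖f‖²; hence the constant 2t.
  refine (Finset.sum_le_sum fun i _ ↦ hI i).trans ?_
  rw [Finset.sum_add_distrib, ← Finset.mul_sum, Finset.sum_comm, Finset.sum_const, Finset.card_univ,
    nsmul_eq_mul, hι, form_regularChar]
  have h1 : ∑ g ∈ S, ∑ i, e i g ≤ ∑ g ∈ S, f.coeff g * f.coeff g :=
    Finset.sum_le_sum fun g _ ↦ hsum_e g
  have h2 := mul_le_mul_of_nonneg_left h1 ht.le
  have h3 : t * t * (1 / t * ∑ g ∈ S, f.coeff g * f.coeff g) =
      t * ∑ g ∈ S, f.coeff g * f.coeff g := by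
    field_simp
  rw [h3]
  linarith

/-- The diagonal embedding of group algebras. -/
noncomputable abbrev diagHom (G : Type*) [Group G] :
    MonoidAlgebra ℝ G →ₐ[ℝ] MonoidAlgebra ℝ (G × G) :=
  mapDomainAlgHom ℝ ℝ ((MonoidHom.id G).prod (MonoidHom.id G))

/-- The character of `G × G` whose restriction to the diagonal is the regular one and whose
restriction to the second factor is `φ`. -/
noncomputable def twistedChar (φ : G → ℝ) : G × G → ℝ :=
  fun p ↦ regularChar G p.1 * φ p.2

/-- Replace `x` by `(1, x)` in the diagonal image of `A`. -/
noncomputable def twist (A : MonoidAlgebra ℝ G) (x : G) :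
    MonoidAlgebra ℝ (G × G) :=
  diagHom G (A - single x 1) +
    single ((1 : G), x) 1

theorem isNonneg_twist {A : MonoidAlgebra ℝ G} (hA : A.IsNonneg) {x : G} (hx : 1 ≤ A.coeff x) :
    (twist A x).IsNonneg := by
  classical
  refine (IsNonneg.mapDomainAlgHom (fun g ↦ ?_) _).add (isNonneg_single _ zero_le_one)
  rw [coeff_sub, Finsupp.sub_apply, coeff_single, Finsupp.single_apply]
  split_ifs with h
  · rw [← h]; linarith
  · linarith [hA g]

theorem mapDomainAlgHom_snd_twist (A : MonoidAlgebra ℝ G) (x : G) :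
    mapDomainAlgHom ℝ ℝ (MonoidHom.snd G G) (twist A x) = A := by
  have h : ∀ P : MonoidAlgebra ℝ G, mapDomainAlgHom ℝ ℝ (MonoidHom.snd G G)
      (diagHom G P) = P := by
    intro P
    induction P using induction_linear with
    | zero => simp
    | add x y hx hy => rw [map_add, map_add, hx, hy]
    | single g a => simp
  rw [twist, map_add, h]
  simp

theorem form_twistedChar_diag {φ : G → ℝ} (h1 : φ 1 = 1) (P Q : MonoidAlgebra ℝ G) :
    form (twistedChar φ) (diagHom G P)
      (diagHom G Q) =
      form (regularChar G) P Q := by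
  rw [form_mapDomainAlgHom]
  have h : twistedChar φ ∘ (MonoidHom.id G).prod (MonoidHom.id G) = regularChar G := by
    funext g
    by_cases h : g = 1
    · simp [twistedChar, h, h1]
    · simp [twistedChar, regularChar, h]
  rw [h]

/-- The regular first coordinate forces `g' = g`, and then φ(g⁻¹ x g) = φ(x) by conjugation
invariance. -/
theorem form_twistedChar_snd {φ : G → ℝ} (hconj : ∀ g h, φ (h * g * h⁻¹) = φ g) (x : G)
    (P Q : MonoidAlgebra ℝ G) :
    form (twistedChar φ) (diagHom G P)
      (single ((1 : G), x) 1 * diagHom G Q) =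
      φ x * form (regularChar G) P Q := by
  have : (form (twistedChar φ)).compl₁₂
      (diagHom G).toLinearMap
      (LinearMap.mulLeft ℝ (single ((1 : G), x) 1) ∘ₗ
        (diagHom G).toLinearMap) =
      φ x • form (regularChar G) := by
    refine bilinForm_ext_single fun g g' a b ↦ ?_
    simp only [LinearMap.compl₁₂_apply, AlgHom.toLinearMap_apply, mapDomainAlgHom_apply,
      mapDomain_single, LinearMap.comp_apply, LinearMap.mulLeft_apply, single_mul_single,
      form_single_single, LinearMap.smul_apply, smul_eq_mul, one_mul, MonoidHom.prod_apply,
      MonoidHom.id_apply, Prod.mk_mul_mk, Prod.inv_mk, twistedChar]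
    by_cases h : g⁻¹ * g' = 1
    · have hg : g' = g := (inv_mul_eq_one.1 h).symm
      have h2 := hconj x g⁻¹
      rw [inv_inv] at h2
      rw [hg, ← mul_assoc g⁻¹, h2]
      ring
    · simp [regularChar, h]
  exact congrArg (fun B ↦ B P Q) this

theorem form_twist_mul {φ : G → ℝ} (h1 : φ 1 = 1) (hconj : ∀ g h, φ (h * g * h⁻¹) = φ g)
    (A : MonoidAlgebra ℝ G) (x : G) (f : MonoidAlgebra ℝ G) :
    form (twistedChar φ) (diagHom G f)
      (twist A x * diagHom G f) =
      form (regularChar G) f (A * f) - form (regularChar G) f (single x 1 * f) +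
        φ x * form (regularChar G) f f := by
  rw [twist, add_mul, map_add, form_twistedChar_snd hconj, ← map_mul, form_twistedChar_diag h1,
    sub_mul, map_sub]

/-- One twist breaks symmetry, since it moves (x, x) but not its inverse; twisting also by `x⁻¹`
restores it. -/
theorem isSymmetric_twist_add_twist_inv {A : MonoidAlgebra ℝ (G)}
    (hA : (diagHom G A).IsSymmetric) (x : G) :
    (twist A x + twist A x⁻¹).IsSymmetric := by
  have h : twist A x + twist A x⁻¹ =
      (diagHom G A +
        diagHom G A) -
        (single (x, x) 1 + single (x, x)⁻¹ 1) + (single ((1 : G), x) 1 + single ((1 : G), x)⁻¹ 1) := by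
    simp only [twist, map_sub, mapDomainAlgHom_apply, mapDomain_single, MonoidHom.prod_apply,
      MonoidHom.id_apply, Prod.inv_mk, inv_one]
    abel
  rw [h]
  exact ((hA.add hA).sub (isSymmetric_single_add_single_inv _ _)).add
    (isSymmetric_single_add_single_inv _ _)

/-- The regular character takes only the values 0 and 1, so forgetting the first coordinate
increases the form on nonnegative elements. -/
theorem form_twistedChar_le {φ : G → ℝ} (h0 : ∀ g, 0 ≤ φ g) {P Q : MonoidAlgebra ℝ (G × G)}
    (hP : P.IsNonneg) (hQ : Q.IsNonneg) :
    form (twistedChar φ) P Q ≤ form φ (mapDomainAlgHom ℝ ℝ (MonoidHom.snd G G) P)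
      (mapDomainAlgHom ℝ ℝ (MonoidHom.snd G G) Q) := by
  rw [form_mapDomainAlgHom]
  refine form_mono (fun g ↦ ?_) hP hQ
  rw [twistedChar, regularChar, Function.comp_apply, MonoidHom.coe_snd]
  split_ifs
  · rw [one_mul]
  · rw [zero_mul]; exact h0 _

theorem isPosDefFun_twistedChar {φ : G → ℝ} (hφ : IsPosDefFun φ) : IsPosDefFun (twistedChar φ) :=
  (isPosDefFun_regularChar.comp (MonoidHom.fst G G)).mul (hφ.comp (MonoidHom.snd G G))

end MonoidAlgebra

/-! ### Ping-pong conjugates and the rigidity argument -/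

namespace FreeGroup

open MonoidAlgebra

variable {α : Type*} [Fintype α] [DecidableEq α]

/-- Every nontrivial element of a nonabelian free group has conjugates that play ping-pong. -/
theorem exists_pingPong_conj (hα : 2 ≤ Fintype.card α) {v : FreeGroup α} (hv : v ≠ 1) :
    ∃ (g : ℕ → FreeGroup α) (D : ℕ → Set (FreeGroup α)),
      (Pairwise fun i j ↦ Disjoint (D i) (D j)) ∧ ∀ i, ∀ h ∉ D i, g i * v * (g i)⁻¹ * h ∈ D i := by
  have hw : v.toWord ≠ [] := fun h ↦ hv (toWord_eq_nil_iff.1 h)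
  set s := v.toWord.head hw with hs
  set t := v.toWord.getLast hw with ht
  -- Avoiding these two letters makes d v d⁻¹ reduced as written. Two generators give four letters,
  -- so such a `d` exists.
  obtain ⟨d, hd⟩ : ∃ d : α × Bool, d ∉ ({(s.1, !s.2), t} : Finset (α × Bool)) := by
    by_contra! h
    have h1 : Finset.univ ⊆ ({(s.1, !s.2), t} : Finset (α × Bool)) := fun d _ ↦ h d
    have h2 := (Finset.card_le_card h1).trans Finset.card_le_two
    rw [Finset.card_univ, Fintype.card_prod, Fintype.card_bool] at h2
    omega
  simp only [Finset.mem_insert, Finset.mem_singleton, not_or] at hd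
  obtain ⟨r, hr⟩ : ∃ r : α, r ≠ d.1 := by
    have : Nontrivial α := Fintype.one_lt_card_iff_nontrivial.1 (by omega)
    exact exists_ne d.1
  set R : FreeGroup α := mk [(r, true)] with hR
  have hRpow : ∀ k : ℕ, ∀ b ∈ startsWith d, R ^ (k + 1) * b ∈ startsWith (r, true) := by
    intro k b hb
    induction k with
    | zero =>
      rw [zero_add, pow_one]
      refine startsWith_mk_mul b fun hb' ↦ Set.disjoint_left.1 (startsWith.disjoint_iff_ne.2 ?_) hb hb'
      rintro rfl
      exact hr rfl
    | succ k ih =>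
      rw [pow_succ', mul_assoc]
      refine startsWith_mk_mul _ fun hb' ↦
        Set.disjoint_left.1 (startsWith.disjoint_iff_ne.2 ?_) ih hb'
      simp
  have hdisj : ∀ i j : ℕ, i < j →
      Disjoint {h | (R ^ i)⁻¹ * h ∈ startsWith d} {h | (R ^ j)⁻¹ * h ∈ startsWith d} := by
    intro i j hij
    rw [Set.disjoint_left]
    intro h hi hj
    obtain ⟨k, rfl⟩ := Nat.exists_eq_add_of_lt hij
    have h1 := hRpow k _ hj
    have h2 : R ^ (k + 1) * ((R ^ (i + k + 1))⁻¹ * h) = (R ^ i)⁻¹ * h := by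
      rw [add_assoc, pow_add R i]
      group
    rw [h2] at h1
    refine Set.disjoint_left.1 (startsWith.disjoint_iff_ne.2 ?_) h1 hi
    rintro rfl
    exact hr rfl
  -- `D i` is R^i times the words starting with `d`. These sets are disjoint because `R` is another
  -- generator. Outside `D i`, applying d⁻¹ R^(-i) gives a word starting with d⁻¹; then neither `v`
  -- nor `d` causes cancellation.
  refine ⟨fun i ↦ R ^ i * mk [d], fun i ↦ {h | (R ^ i)⁻¹ * h ∈ startsWith d}, ?_, ?_⟩
  · intro i j hij
    rcases lt_or_gt_of_ne hij with h | h
    · exact hdisj i j h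
    · exact (hdisj j i h).symm
  · intro i h hh
    simp only [Set.mem_ofPred_eq] at hh ⊢
    have h1 : (R ^ i)⁻¹ * (R ^ i * mk [d] * v * (R ^ i * mk [d])⁻¹ * h) =
        mk [d] * (v * (mk [(d.1, !d.2)] * ((R ^ i)⁻¹ * h))) := by
      rw [← mk_singleton_inv]
      group
    rw [h1]
    have h2 : mk [(d.1, !d.2)] * ((R ^ i)⁻¹ * h) ∈ startsWith (d.1, !d.2) :=
      startsWith_mk_mul _ (by simpa using hh)
    have h3 : v ∈ startsWith s := by
      simp [startsWith, hs, ← List.head?_eq_getElem?, List.head?_eq_some_head hw]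
    have h4 : v * (mk [(d.1, !d.2)] * ((R ^ i)⁻¹ * h)) ∈ startsWith s := by
      refine mul_mem_startsWith h3 fun t' ht' hmem ↦ ?_
      rw [List.getLast?_eq_some_getLast hw, Option.mem_some_iff, ← ht] at ht'
      subst ht'
      refine Set.disjoint_left.1 (startsWith.disjoint_iff_ne.2 ?_) h2 hmem
      intro h5
      apply hd.2
      rw [Prod.mk.injEq] at h5
      exact Prod.ext h5.1 (by simpa using h5.2)
    refine startsWith_mk_mul _ fun h5 ↦ Set.disjoint_left.1 (startsWith.disjoint_iff_ne.2 ?_) h4 h5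
    intro h6
    apply hd.1
    rw [h6]
    simp

theorem isSymmetric_diag_one_add_letterSum_pow (k : ℕ) :
    (diagHom (FreeGroup α)
      ((1 + letterSum α) ^ k)).IsSymmetric := by
  rw [_root_.map_pow, _root_.map_add, _root_.map_one]
  refine (isSymmetric_one.add ?_).pow k
  -- The letters are closed under inversion, so pairing each with its inverse counts every letter
  -- twice.
  have h : diagHom (FreeGroup α)
      (letterSum α) = (1 / 2 : ℝ) • ∑ s : α × Bool,
        (single (mk [s], mk [s]) 1 + single (mk [s], mk [s])⁻¹ 1) := by
    have h2 : ∑ s : α × Bool, single (mk [s], mk [s])⁻¹ (1 : ℝ) =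
        ∑ s : α × Bool, single (mk [s], mk [s]) (1 : ℝ) := by
      rw [← (letterInv α).sum_comp]
      refine Finset.sum_congr rfl fun s _ ↦ ?_
      simp [letterInv, inv_mk, invRev]
    rw [Finset.sum_add_distrib, h2, ← two_smul ℝ, smul_smul, letterSum, _root_.map_sum]
    norm_num
  rw [h]
  exact (IsSymmetric.sum fun s _ ↦ isSymmetric_single_add_single_inv _ _).smul _

/-- The moments of the adjacency operator for a character bound its quadratic form after some
group elements have been twisted. -/
theorem twisted_form_le {φ : FreeGroup α → ℝ} (h0 : ∀ g, 0 ≤ φ g) (h1 : φ 1 = 1)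
    (hconj : ∀ g h, φ (h * g * h⁻¹) = φ g) (hφ : IsPosDefFun φ) {ρ : ℝ} (hρ : 0 ≤ ρ)
    (hbound : ∀ f : MonoidAlgebra ℝ (FreeGroup α), ∃ C, ∀ n,
      form φ f ((1 + letterSum α) ^ n * f) ≤ C * (1 + ρ) ^ n)
    {f : MonoidAlgebra ℝ (FreeGroup α)} (hf : f.IsNonneg) (k : ℕ) {ι : Type*} [Fintype ι]
    [Nonempty ι] (x : ι → FreeGroup α) (hx : ∀ i, (x i).norm ≤ k) :
    form (regularChar _) f ((1 + letterSum α) ^ k * f) +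
      (∑ i, (φ (x i) * form (regularChar _) f f -
        form (regularChar _) f (single (x i) 1 * f))) / Fintype.card ι ≤
      (1 + ρ) ^ k * form (regularChar _) f f := by
  set A := (1 + letterSum α) ^ k with hA
  set y := diagHom (FreeGroup α) f
    with hy
  -- The average of the 2|ι| twists, normalised so that its second projection is exactly `A`.
  set B : MonoidAlgebra ℝ (FreeGroup α × FreeGroup α) :=
    (1 / (2 * Fintype.card ι) : ℝ) • ∑ i, (twist A (x i) + twist A (x i)⁻¹) with hB
  have hcard : (0 : ℝ) < Fintype.card ι := by exact_mod_cast Fintype.card_pos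
  have hA0 : A.IsNonneg := isNonneg_one_add_letterSum_pow k
  have hB0 : B.IsNonneg := by
    refine IsNonneg.smul (IsNonneg.sum fun i _ ↦ ?_) (by positivity)
    exact (isNonneg_twist hA0 (one_le_coeff_one_add_letterSum_pow k _ (hx i))).add
      (isNonneg_twist hA0 (one_le_coeff_one_add_letterSum_pow k _ (by rw [norm_inv_eq]; exact hx i)))
  have hBs : B.IsSymmetric :=
    (IsSymmetric.sum fun i _ ↦
      isSymmetric_twist_add_twist_inv (isSymmetric_diag_one_add_letterSum_pow k) (x i)).smul _
  have hsnd : mapDomainAlgHom ℝ ℝ (MonoidHom.snd _ _) B = A := by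
    rw [hB, _root_.map_smul, _root_.map_sum]
    simp only [_root_.map_add, mapDomainAlgHom_snd_twist]
    rw [Finset.sum_const, Finset.card_univ, ← two_smul ℝ A, ← Nat.cast_smul_eq_nsmul ℝ, smul_smul,
      smul_smul]
    have : (1 / (2 * Fintype.card ι) * (Fintype.card ι * 2) : ℝ) = 1 := by field_simp
    rw [mul_assoc, this, one_smul]
  have hysnd : mapDomainAlgHom ℝ ℝ (MonoidHom.snd _ _) y = f := by
    have h := mapDomainAlgHom_snd_twist f 1
    rw [twist, _root_.map_sub, _root_.map_add, _root_.map_sub] at h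
    rw [hy]
    simpa using h
  have hy0 : y.IsNonneg := hf.mapDomainAlgHom _
  obtain ⟨C, hC⟩ := hbound f
  -- Passing to the second coordinate replaces `B` by `A` and `y` by `f`, where the assumed moment
  -- bound applies.
  have hgrow : ∀ n, form (twistedChar φ) y (B ^ n * y) ≤ C * ((1 + ρ) ^ k) ^ n := by
    intro n
    refine (form_twistedChar_le h0 hy0 ((hB0.pow n).mul hy0)).trans ?_
    rw [_root_.map_mul, _root_.map_pow, hsnd, hysnd, hA, ← pow_mul, ← pow_mul]
    exact hC _
  have hmain := hBs.form_le_of_pow_le (isPosDefFun_twistedChar hφ) y (by positivity) hgrow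
  rw [hy, form_twistedChar_diag h1, ← hy] at hmain
  have hδ : ∀ x : FreeGroup α, form (regularChar _) f (single x⁻¹ 1 * f) =
      form (regularChar _) f (single x 1 * f) := by
    intro x
    rw [← form_single_mul_left]
    exact isPosDefFun_regularChar.form_isSymm.eq _ _
  have hφinv : ∀ g, φ g⁻¹ = φ g := hφ.inv
  have hexp : form (twistedChar φ) y (B * y) = form (regularChar _) f (A * f) +
      (∑ i, (φ (x i) * form (regularChar _) f f -
        form (regularChar _) f (single (x i) 1 * f))) / Fintype.card ι := by
    rw [hB, smul_mul_assoc, _root_.map_smul, Finset.sum_mul, _root_.map_sum, smul_eq_mul]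
    simp only [add_mul, _root_.map_add, hy, form_twist_mul h1 hconj, hδ, hφinv]
    have h3 : ∀ i, form (regularChar _) f (A * f) - form (regularChar _) f (single (x i) 1 * f) +
        φ (x i) * form (regularChar _) f f +
        (form (regularChar _) f (A * f) - form (regularChar _) f (single (x i) 1 * f) +
          φ (x i) * form (regularChar _) f f) = 2 * form (regularChar _) f (A * f) +
        2 * (φ (x i) * form (regularChar _) f f -
          form (regularChar _) f (single (x i) 1 * f)) := fun i ↦ by ring
    simp only [h3, Finset.sum_add_distrib, Finset.sum_const, Finset.card_univ, nsmul_eq_mul,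
      ← Finset.mul_sum]
    generalize ∑ i, (φ (x i) * form (regularChar _) f f -
      form (regularChar _) f (single (x i) 1 * f)) = S
    field_simp
  rw [hexp] at hmain
  exact hmain

/-- **Kesten's theorem** for characters of free groups. -/
theorem kesten (hα : 2 ≤ Fintype.card α) {φ : FreeGroup α → ℝ} (h0 : ∀ g, 0 ≤ φ g) (h1 : φ 1 = 1)
    (hconj : ∀ g h, φ (h * g * h⁻¹) = φ g) (hφ : IsPosDefFun φ) {ρ : ℝ} (hρ : 0 ≤ ρ)
    (hbound : ∀ f : MonoidAlgebra ℝ (FreeGroup α), ∃ C, ∀ n,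
      form φ f ((1 + letterSum α) ^ n * f) ≤ C * (1 + ρ) ^ n) :
    2 * √(2 * Fintype.card α - 1) ≤ ρ ∧
      (ρ = 2 * √(2 * Fintype.card α - 1) → ∀ v ≠ 1, φ v = 0) := by
  set ρ₀ := 2 * √(2 * (Fintype.card α : ℝ) - 1) with hρ₀
  have hα2 : (2 : ℝ) ≤ Fintype.card α := by exact_mod_cast hα
  have hρ₀pos : 0 < ρ₀ := mul_pos two_pos (Real.sqrt_pos.2 (by linarith))
  -- Lower bound for the moments of an almost eigenvector.
  have hlow : ∀ κ, 0 ≤ κ → ∀ f : MonoidAlgebra ℝ (FreeGroup α), f.IsNonneg →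
      (letterSum α * f - κ • f).IsNonneg → ∀ k,
      (1 + κ) ^ k * form (regularChar _) f f ≤
        form (regularChar _) f ((1 + letterSum α) ^ k * f) := by
    intro κ hκ f hf hκf k
    have hδ0 : ∀ g : FreeGroup α, 0 ≤ regularChar _ g := fun g ↦ by
      rw [regularChar]; split_ifs <;> simp
    have := form_mono_right hδ0 hf (one_add_letterSum_pow_mul_ge hκ hκf k)
    rwa [_root_.map_smul, smul_eq_mul] at this
  refine ⟨?_, ?_⟩
  · refine le_of_forall_lt fun κ hκ ↦ ?_
    obtain ⟨κ', hκ'1, hκ'2⟩ := exists_between (max_lt hκ hρ₀pos)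
    have hκ' : 0 ≤ κ' := (le_max_right _ _).trans hκ'1.le
    obtain ⟨f, hf, hf1, hf2⟩ := exists_letterSum_mul_ge (by omega : 1 ≤ Fintype.card α) hκ'2
    -- Twisting by the identity changes nothing, as φ(1) = 1; what is left is the comparison of φ
    -- with the regular character.
    have h2 := twisted_form_le h0 h1 hconj hφ hρ hbound hf 1 (fun _ : Unit ↦ 1) (by simp)
    have h3 := hlow κ' hκ' f hf hf2 1
    have h4 : (single (1 : FreeGroup α) (1 : ℝ)) = 1 := rfl
    simp only [h1, h4, one_mul, sub_self, Finset.sum_const_zero, zero_div, add_zero, pow_one]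
      at h2 h3
    have h5 := le_of_mul_le_mul_right (h3.trans h2) hf1
    linarith [le_max_left κ 0]
  · intro hρeq v hv
    by_contra hne
    have hc : 0 < φ v := lt_of_le_of_ne (h0 v) (Ne.symm hne)
    -- With t² ping-pong conjugates the averaged loss is at most 2t/t² = 2/t, so this `t` makes the
    -- gain φ(v) - 2/t positive.
    obtain ⟨t, ht⟩ := exists_nat_gt (2 / φ v)
    have ht0 : (0 : ℝ) < t := lt_trans (by positivity) ht
    have htc : 2 < φ v * t := by rwa [div_lt_iff₀ hc, mul_comm] at ht
    obtain ⟨g, D, hD, hgD⟩ := exists_pingPong_conj hα hv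
    let ι := Fin (t * t)
    let x : ι → FreeGroup α := fun i ↦ g i * v * (g i)⁻¹
    have ht1 : 0 < t := by exact_mod_cast ht0
    have : Nonempty ι := ⟨⟨0, by positivity⟩⟩
    obtain ⟨k, hk⟩ : ∃ k, ∀ i, (x i).norm ≤ k :=
      ⟨Finset.univ.sup fun i ↦ (x i).norm, fun i ↦ Finset.le_sup (f := fun i ↦ (x i).norm)
        (Finset.mem_univ i)⟩
    have hcard : (Fintype.card ι : ℝ) = t * t := by
      rw [Fintype.card_fin]; push_cast; rfl
    set δ := φ v - 2 / t with hδ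
    have hδ0 : 0 < δ := by
      rw [hδ, sub_pos, div_lt_iff₀ ht0]; exact htc
    have hle : ∀ κ, 0 ≤ κ → κ < ρ₀ → (1 + κ) ^ k + δ ≤ (1 + ρ) ^ k := by
      intro κ hκ hκρ
      obtain ⟨f, hf, hf1, hf2⟩ := exists_letterSum_mul_ge (by omega : 1 ≤ Fintype.card α) hκρ
      have h2 := twisted_form_le h0 h1 hconj hφ hρ hbound hf k x hk
      have h3 := hlow κ hκ f hf hf2 k
      have h4 := sum_form_regularChar_le ht0 hcard x (fun i ↦ D i)
        (fun i j hij ↦ hD (fun h ↦ hij (Fin.ext h))) (fun i ↦ hgD i) f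
      have h5 : ∀ i, φ (x i) = φ v := fun i ↦ hconj _ _
      simp only [h5, Finset.sum_sub_distrib, Finset.sum_const, Finset.card_univ, nsmul_eq_mul] at h2
      rw [hcard] at h2
      have h6 : δ * form (regularChar _) f f ≤
          (t * t * (φ v * form (regularChar _) f f) -
            ∑ i, form (regularChar _) f (single (x i) 1 * f)) / (t * t) := by
        rw [le_div_iff₀ (by positivity)]
        have h7 : δ * form (regularChar _) f f * (t * t) =
            t * t * (φ v * form (regularChar _) f f) - 2 * t * form (regularChar _) f f := by
          rw [hδ]
          field_simp
        rw [h7]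
        linarith
      have h8 : ((1 + κ) ^ k + δ) * form (regularChar _) f f ≤
          (1 + ρ) ^ k * form (regularChar _) f f := by
        rw [add_mul]
        linarith
      exact le_of_mul_le_mul_right h8 hf1
    -- `k` and `δ` were fixed before `f`, so κ may tend to ρ₀ and the gain `δ` survives in the
    -- limit.
    have hlim : Filter.Tendsto (fun κ : ℝ ↦ (1 + κ) ^ k + δ) (nhdsWithin ρ₀ (Set.Iio ρ₀))
        (nhds ((1 + ρ₀) ^ k + δ)) := by
      refine Filter.Tendsto.mono_left ?_ nhdsWithin_le_nhds
      have : Continuous fun κ : ℝ ↦ (1 + κ) ^ k + δ := by fun_prop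
      exact this.tendsto ρ₀
    have hev : ∀ᶠ κ in nhdsWithin ρ₀ (Set.Iio ρ₀), (1 + κ) ^ k + δ ≤ (1 + ρ) ^ k := by
      have h9 : ∀ᶠ κ in nhdsWithin ρ₀ (Set.Iio ρ₀), (0 : ℝ) < κ :=
        nhdsWithin_le_nhds (lt_mem_nhds hρ₀pos)
      filter_upwards [h9, self_mem_nhdsWithin] with κ hκ hκ'
      exact hle κ hκ.le hκ'
    have hfin := le_of_tendsto hlim hev
    rw [hρeq] at hfin
    linarith

end FreeGroup

/-! ### Operators on Hilbert space tensor products -/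

section HilbertTensor

universe u v

variable {H : Type u} [NormedAddCommGroup H] [InnerProductSpace ℂ H]
  {K : Type v} [NormedAddCommGroup K] [InnerProductSpace ℂ K]

/-- The elementary tensor `ξ ⊗ η`. -/
noncomputable def pureTensor (ξ : H) (η : K) : HilbertTensor H K := ((ξ ⊗ₜ[ℂ] η : H ⊗[ℂ] K) :)

theorem inner_pureTensor (ξ ξ' : H) (η η' : K) :
    ⟪pureTensor ξ η, pureTensor ξ' η'⟫_ℂ = ⟪ξ, ξ'⟫_ℂ * ⟪η, η'⟫_ℂ := by
  rw [pureTensor, pureTensor, UniformSpace.Completion.inner_coe, TensorProduct.inner_tmul]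

theorem tensorOp_pureTensor (x : H →L[ℂ] H) (y : K →L[ℂ] K) (ξ : H) (η : K) :
    tensorOp x y (pureTensor ξ η) = pureTensor (x ξ) (y η) := by
  rw [tensorOp, pureTensor, ContinuousLinearMap.completion_apply_coe, TensorProduct.mapL_tmul,
    pureTensor]

theorem HilbertTensor.ext_pureTensor {E : Type*} [NormedAddCommGroup E] [NormedSpace ℂ E]
    {S T : HilbertTensor H K →L[ℂ] E} (h : ∀ ξ η, S (pureTensor ξ η) = T (pureTensor ξ η)) :
    S = T := by
  refine ContinuousLinearMap.ext fun z ↦ ?_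
  refine UniformSpace.Completion.induction_on z (isClosed_eq S.continuous T.continuous) fun w ↦ ?_
  induction w using TensorProduct.induction_on with
  | zero => rw [UniformSpace.Completion.coe_zero, map_zero, map_zero]
  | tmul ξ η => exact h ξ η
  | add x y hx hy => rw [UniformSpace.Completion.coe_add, map_add, map_add, hx, hy]

theorem tensorOp_mul (x x' : H →L[ℂ] H) (y y' : K →L[ℂ] K) :
    tensorOp (x * x') (y * y') = tensorOp x y * tensorOp x' y' :=
  HilbertTensor.ext_pureTensor fun ξ η ↦ by
    simp only [mul_apply_eq_comp, tensorOp_pureTensor]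

theorem tensorOp_one : tensorOp (1 : H →L[ℂ] H) (1 : K →L[ℂ] K) = 1 :=
  HilbertTensor.ext_pureTensor fun ξ η ↦ by
    simp only [one_apply_eq_self, tensorOp_pureTensor]

/-- The operator `η ↦ ξ ⊗ η`. -/
noncomputable def leftEmb (K : Type v) [NormedAddCommGroup K] [InnerProductSpace ℂ K] (ξ : H) :
    K →L[ℂ] HilbertTensor H K :=
  UniformSpace.Completion.toComplL ∘L TensorProduct.mkL ℂ H K ξ

/-- The operator `ξ ↦ ξ ⊗ η`. -/
noncomputable def rightEmb (H : Type u) [NormedAddCommGroup H] [InnerProductSpace ℂ H] (η : K) :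
    H →L[ℂ] HilbertTensor H K :=
  UniformSpace.Completion.toComplL ∘L (TensorProduct.mkL ℂ H K).flip η

theorem rightEmb_apply (ξ : H) (η : K) : rightEmb H η ξ = pureTensor ξ η := rfl

theorem norm_pureTensor (ξ : H) (η : K) : ‖pureTensor ξ η‖ = ‖ξ‖ * ‖η‖ := by
  rw [pureTensor, UniformSpace.Completion.norm_coe, TensorProduct.norm_tmul]

theorem norm_rightEmb_le (η : K) : ‖rightEmb H η‖ ≤ ‖η‖ :=
  ContinuousLinearMap.opNorm_le_bound _ (norm_nonneg _) fun ξ ↦ by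
    rw [rightEmb_apply, norm_pureTensor, mul_comm]

variable [CompleteSpace H] [CompleteSpace K]

theorem star_tensorOp (x : H →L[ℂ] H) (y : K →L[ℂ] K) :
    star (tensorOp x y) = tensorOp (star x) (star y) := by
  refine HilbertTensor.ext_pureTensor fun ξ η ↦ ?_
  have key : ∀ a b : HilbertTensor H K,
      innerSL ℂ a = innerSL ℂ b → a = b := fun a b hab ↦
    ext_inner_right ℂ fun z ↦ congrArg (fun L ↦ L z) hab
  refine key _ _ (HilbertTensor.ext_pureTensor fun ξ' η' ↦ ?_)
  simp only [innerSL_apply_apply, ContinuousLinearMap.star_eq_adjoint,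
    ContinuousLinearMap.adjoint_inner_left, tensorOp_pureTensor, inner_pureTensor]

/-- The slice of an operator by a vector functional of the first factor. -/
noncomputable def leftSlice (ξ ξ' : H) (X : HilbertTensor H K →L[ℂ] HilbertTensor H K) :
    K →L[ℂ] K :=
  (leftEmb K ξ).adjoint ∘L X ∘L leftEmb K ξ'

/-- The slice of an operator by a vector functional of the second factor. -/
noncomputable def rightSlice (η η' : K) (X : HilbertTensor H K →L[ℂ] HilbertTensor H K) :
    H →L[ℂ] H :=
  (rightEmb H η).adjoint ∘L X ∘L rightEmb H η'

theorem inner_leftSlice (ξ ξ' : H) (η η' : K) (X : HilbertTensor H K →L[ℂ] HilbertTensor H K) :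
    ⟪η, leftSlice ξ ξ' X η'⟫_ℂ = ⟪pureTensor ξ η, X (pureTensor ξ' η')⟫_ℂ := by
  rw [leftSlice, ContinuousLinearMap.comp_apply, ContinuousLinearMap.adjoint_inner_right]
  rfl

theorem inner_rightSlice (ξ ξ' : H) (η η' : K) (X : HilbertTensor H K →L[ℂ] HilbertTensor H K) :
    ⟪ξ, rightSlice η η' X ξ'⟫_ℂ = ⟪pureTensor ξ η, X (pureTensor ξ' η')⟫_ℂ := by
  rw [rightSlice, ContinuousLinearMap.comp_apply, ContinuousLinearMap.adjoint_inner_right]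
  rfl

theorem rightSlice_tensorOp (η η' : K) (x : H →L[ℂ] H) (y : K →L[ℂ] K) :
    rightSlice η η' (tensorOp x y) = ⟪η, y η'⟫_ℂ • x := by
  refine ContinuousLinearMap.ext fun ξ' ↦ ext_inner_left ℂ fun ξ ↦ ?_
  rw [inner_rightSlice, tensorOp_pureTensor, inner_pureTensor, smul_apply,
    inner_smul_right, mul_comm]

/-- An operator 1 ⊗ y passes through the vector functional on the first factor. Thus slices of
operators commuting with 1 ⊗ N' commute with N', and lie in N by the double commutant theorem. -/
theorem leftSlice_commute (ξ ξ' : H) {X : HilbertTensor H K →L[ℂ] HilbertTensor H K} {y : K →L[ℂ] K}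
    (h : Commute (tensorOp 1 y) X) : Commute y (leftSlice ξ ξ' X) := by
  refine ContinuousLinearMap.ext fun η' ↦ ext_inner_left ℂ fun η ↦ ?_
  rw [mul_apply_eq_comp, mul_apply_eq_comp, inner_leftSlice,
    ← ContinuousLinearMap.adjoint_inner_left, inner_leftSlice]
  have h1 : pureTensor ξ' (y η') = tensorOp 1 y (pureTensor ξ' η') := by
    rw [tensorOp_pureTensor]; rfl
  have h2 : pureTensor ξ (y.adjoint η) = (tensorOp (1 : H →L[ℂ] H) y).adjoint (pureTensor ξ η) := by
    rw [← ContinuousLinearMap.star_eq_adjoint, ← ContinuousLinearMap.star_eq_adjoint, star_tensorOp,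
      tensorOp_pureTensor, star_one]; rfl
  rw [h1, h2, ContinuousLinearMap.adjoint_inner_left, ← mul_apply_eq_comp, h.eq,
    mul_apply_eq_comp]

theorem rightSlice_commute (η η' : K) {X : HilbertTensor H K →L[ℂ] HilbertTensor H K}
    {x : H →L[ℂ] H} (h : Commute (tensorOp x 1) X) : Commute x (rightSlice η η' X) := by
  refine ContinuousLinearMap.ext fun ξ' ↦ ext_inner_left ℂ fun ξ ↦ ?_
  rw [mul_apply_eq_comp, mul_apply_eq_comp, inner_rightSlice,
    ← ContinuousLinearMap.adjoint_inner_left, inner_rightSlice]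
  have h1 : pureTensor (x ξ') η' = tensorOp x 1 (pureTensor ξ' η') := by
    rw [tensorOp_pureTensor]; rfl
  have h2 : pureTensor (x.adjoint ξ) η = (tensorOp x (1 : K →L[ℂ] K)).adjoint (pureTensor ξ η) := by
    rw [← ContinuousLinearMap.star_eq_adjoint, ← ContinuousLinearMap.star_eq_adjoint, star_tensorOp,
      tensorOp_pureTensor, star_one]; rfl
  rw [h1, h2, ContinuousLinearMap.adjoint_inner_left, ← mul_apply_eq_comp, h.eq,
    mul_apply_eq_comp]

theorem nonneg_of_inner_nonneg {E : Type*} [NormedAddCommGroup E] [InnerProductSpace ℂ E]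
    {T : E →L[ℂ] E} (h : ∀ x, 0 ≤ ⟪x, T x⟫_ℂ) : 0 ≤ T := by
  rw [ContinuousLinearMap.nonneg_iff_isPositive, ContinuousLinearMap.isPositive_iff_complex]
  intro x
  have h1 := Complex.nonneg_iff.1 (h x)
  have h2 : ⟪T x, x⟫_ℂ = ⟪x, T x⟫_ℂ := by
    rw [← inner_conj_symm]
    exact Complex.conj_eq_iff_im.2 h1.2.symm
  rw [h2]
  exact ⟨Complex.ext rfl h1.2, h1.1⟩

theorem exists_sqrt_of_nonneg {E : Type*} [NormedAddCommGroup E] [InnerProductSpace ℂ E]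
    [CompleteSpace E] {X : E →L[ℂ] E} (hX : 0 ≤ X) :
    ∃ S : E →L[ℂ] E, star S = S ∧ S * S = X ∧ ∀ Y, Commute X Y → Commute S Y :=
  ⟨CFC.sqrt X, (CFC.sqrt_nonneg X).isSelfAdjoint, CFC.sqrt_mul_sqrt_self X hX, fun Y hY ↦ by
    rw [CFC.sqrt_eq_cfc]
    exact hY.cfc_nnreal _⟩

theorem leftSlice_nonneg (ξ : H) {X : HilbertTensor H K →L[ℂ] HilbertTensor H K} (hX : 0 ≤ X) :
    0 ≤ leftSlice ξ ξ X :=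
  nonneg_of_inner_nonneg fun η ↦ by
    rw [inner_leftSlice]
    exact ((ContinuousLinearMap.nonneg_iff_isPositive X).1 hX).inner_nonneg_right _

/-- A positive operator on a tensor product is determined by its diagonal coefficients at elementary
tensors being zero. -/
theorem eq_zero_of_inner_pureTensor_eq_zero {X : HilbertTensor H K →L[ℂ] HilbertTensor H K}
    (hX : 0 ≤ X) (h : ∀ ξ η, ⟪pureTensor ξ η, X (pureTensor ξ η)⟫_ℂ = 0) : X = 0 := by
  obtain ⟨S, hsa, hs, -⟩ := exists_sqrt_of_nonneg hX
  -- For the positive square root, the hypothesis says ‖S(ξ ⊗ η)‖² = 0, and elementary tensors span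
  -- a dense subspace.
  have h0 : S = 0 := HilbertTensor.ext_pureTensor fun ξ η ↦ by
    have := h ξ η
    rw [← hs, mul_apply_eq_comp] at this
    nth_rewrite 1 [← hsa] at this
    rw [ContinuousLinearMap.star_eq_adjoint, ContinuousLinearMap.adjoint_inner_right,
      inner_self_eq_zero] at this
    exact this
  rw [← hs, h0, zero_mul]

end HilbertTensor

/-! ### Normal functionals and product functionals -/

section SeriesFunctional

universe u v

variable {H : Type u} [NormedAddCommGroup H] [InnerProductSpace ℂ H]
  {K : Type v} [NormedAddCommGroup K] [InnerProductSpace ℂ K]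
  {ι κ : Type*}

/-- The sum of a series of bounded operators. -/
noncomputable def operatorSeries {E F : Type*} [NormedAddCommGroup E] [NormedSpace ℂ E]
    [NormedAddCommGroup F] [NormedSpace ℂ F] (f : ι → E →L[ℂ] F) : E →L[ℂ] F :=
  ∑' i, f i

theorem hasSum_operatorSeries {E F : Type*} [NormedAddCommGroup E] [NormedSpace ℂ E]
    [NormedAddCommGroup F] [NormedSpace ℂ F] [CompleteSpace F] {f : ι → E →L[ℂ] F} {b : ι → ℝ}
    (hb : Summable b) (h0 : ∀ i, 0 ≤ b i) (hf : ∀ i x, ‖f i x‖ ≤ b i * ‖x‖) (x : E) :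
    HasSum (fun i ↦ f i x) (operatorSeries f x) :=
  (Summable.of_norm_bounded hb fun i ↦
    (f i).opNorm_le_bound (h0 i) (hf i)).hasSum.mapL (ContinuousLinearMap.apply ℂ F x)

/-- The vector functional `x ↦ ⟪η, x ξ⟫`. -/
noncomputable def vectorFunctional (η ξ : H) : (H →L[ℂ] H) →L[ℂ] ℂ :=
  innerSL ℂ η ∘L ContinuousLinearMap.apply ℂ H ξ

theorem vectorFunctional_apply (η ξ : H) (x : H →L[ℂ] H) :
    vectorFunctional η ξ x = ⟪η, x ξ⟫_ℂ := rfl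

theorem norm_vectorFunctional_le (η ξ : H) (x : H →L[ℂ] H) :
    ‖vectorFunctional η ξ x‖ ≤ ‖η‖ * ‖ξ‖ * ‖x‖ := by
  rw [vectorFunctional_apply]
  calc ‖⟪η, x ξ⟫_ℂ‖ ≤ ‖η‖ * ‖x ξ‖ := norm_inner_le_norm _ _
    _ ≤ ‖η‖ * (‖x‖ * ‖ξ‖) := by gcongr; exact x.le_opNorm ξ
    _ = _ := by ring

/-- The normal functional `x ↦ ∑ᵢ ⟪cᵢ, x dᵢ⟫`. -/
noncomputable def seriesFunctional (c d : ι → H) : (H →L[ℂ] H) →L[ℂ] ℂ :=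
  operatorSeries fun i ↦ vectorFunctional (c i) (d i)

theorem hasSum_seriesFunctional {c d : ι → H} (h : Summable fun i ↦ ‖c i‖ * ‖d i‖)
    (x : H →L[ℂ] H) : HasSum (fun i ↦ ⟪c i, x (d i)⟫_ℂ) (seriesFunctional c d x) :=
  hasSum_operatorSeries h (fun _ ↦ by positivity) (fun i ↦ norm_vectorFunctional_le (c i) (d i)) x

variable [CompleteSpace H] [CompleteSpace K]

section

variable {E : Type*} [NormedAddCommGroup E] [InnerProductSpace ℂ E] [CompleteSpace E]

/-- The map `X ↦ V* X W`. -/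
noncomputable def sandwich (V W : H →L[ℂ] E) : (E →L[ℂ] E) →L[ℂ] (H →L[ℂ] H) :=
  ContinuousLinearMap.compL ℂ H E H V.adjoint ∘L (ContinuousLinearMap.compL ℂ H E E).flip W

theorem sandwich_apply (V W : H →L[ℂ] E) (X : E →L[ℂ] E) :
    sandwich V W X = V.adjoint ∘L X ∘L W := rfl

theorem norm_sandwich_le (V W : H →L[ℂ] E) (X : E →L[ℂ] E) :
    ‖sandwich V W X‖ ≤ ‖V‖ * ‖W‖ * ‖X‖ := by
  rw [sandwich_apply]
  calc ‖V.adjoint ∘L X ∘L W‖ ≤ ‖V.adjoint‖ * (‖X‖ * ‖W‖) :=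
        (ContinuousLinearMap.opNorm_comp_le _ _).trans
          (mul_le_mul_of_nonneg_left (ContinuousLinearMap.opNorm_comp_le _ _) (norm_nonneg _))
    _ = ‖V‖ * ‖W‖ * ‖X‖ := by rw [LinearIsometryEquiv.norm_map]; ring

/-- The map `X ↦ ∑ᵢ Vᵢ* X Wᵢ`. -/
noncomputable def sandwichSeries (V W : ι → H →L[ℂ] E) : (E →L[ℂ] E) →L[ℂ] (H →L[ℂ] H) :=
  operatorSeries fun i ↦ sandwich (V i) (W i)

theorem hasSum_sandwichSeries {V W : ι → H →L[ℂ] E} (h : Summable fun i ↦ ‖V i‖ * ‖W i‖)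
    (X : E →L[ℂ] E) :
    HasSum (fun i ↦ (V i).adjoint ∘L X ∘L W i) (sandwichSeries V W X) := by
  have h1 : HasSum (fun i ↦ sandwich (V i) (W i) X) (sandwichSeries V W X) :=
    hasSum_operatorSeries h (fun _ ↦ mul_nonneg (norm_nonneg _) (norm_nonneg _))
      (fun i ↦ norm_sandwich_le (V i) (W i)) X
  simpa only [sandwich_apply] using h1

end

/-- The slice map by a normal functional of the second factor. -/
noncomputable def seriesSlice (H : Type u) [NormedAddCommGroup H] [InnerProductSpace ℂ H]
    [CompleteSpace H] (a b : ι → K) :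
    (HilbertTensor H K →L[ℂ] HilbertTensor H K) →L[ℂ] (H →L[ℂ] H) :=
  sandwichSeries (fun i ↦ rightEmb H (a i)) fun i ↦ rightEmb H (b i)

theorem hasSum_seriesSlice {a b : ι → K} (h : Summable fun i ↦ ‖a i‖ * ‖b i‖)
    (X : HilbertTensor H K →L[ℂ] HilbertTensor H K) :
    HasSum (fun i ↦ rightSlice (a i) (b i) X) (seriesSlice H a b X) :=
  hasSum_sandwichSeries (Summable.of_nonneg_of_le (fun _ ↦ by positivity)
    (fun i ↦ mul_le_mul (norm_rightEmb_le (a i)) (norm_rightEmb_le (b i)) (norm_nonneg _)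
      (norm_nonneg _)) h) X

/-- A Fubini identity: slicing the second factor and then the first agrees with the opposite order.
It transfers positivity and faithfulness from one factor to the slice in the other. -/
theorem inner_seriesSlice {a b : ι → K} (h : Summable fun i ↦ ‖a i‖ * ‖b i‖)
    (X : HilbertTensor H K →L[ℂ] HilbertTensor H K) (ξ ξ' : H) :
    ⟪ξ, seriesSlice H a b X ξ'⟫_ℂ = seriesFunctional a b (leftSlice ξ ξ' X) := by
  refine ((hasSum_seriesSlice h X).mapL (vectorFunctional ξ ξ')).unique ?_
  refine (hasSum_seriesFunctional h (leftSlice ξ ξ' X)).congr_fun fun i ↦ ?_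
  rw [vectorFunctional_apply, inner_rightSlice, inner_leftSlice]

theorem seriesSlice_tensorOp {a b : ι → K} (h : Summable fun i ↦ ‖a i‖ * ‖b i‖)
    (x : H →L[ℂ] H) (y : K →L[ℂ] K) :
    seriesSlice H a b (tensorOp x y) = seriesFunctional a b y • x := by
  refine (hasSum_seriesSlice h _).unique ?_
  refine ((hasSum_seriesFunctional h y).smul_const x).congr_fun fun i ↦ ?_
  rw [rightSlice_tensorOp]

/-- The product of two normal functionals. -/
noncomputable def productFunctional (c d : ι → H) (a b : κ → K) :
    (HilbertTensor H K →L[ℂ] HilbertTensor H K) →L[ℂ] ℂ :=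
  seriesFunctional c d ∘L seriesSlice H a b

theorem productFunctional_tensorOp (c d : ι → H) {a b : κ → K}
    (h : Summable fun i ↦ ‖a i‖ * ‖b i‖) (x : H →L[ℂ] H) (y : K →L[ℂ] K) :
    productFunctional c d a b (tensorOp x y) = seriesFunctional c d x * seriesFunctional a b y := by
  rw [productFunctional, ContinuousLinearMap.comp_apply, seriesSlice_tensorOp h, map_smul,
    smul_eq_mul, mul_comm]

namespace VonNeumannAlgebra

/-- The series `x ↦ ∑ᵢ ⟪cᵢ, x dᵢ⟫` is a faithful positive functional on `M`. -/
structure IsFaithfulSeries (M : VonNeumannAlgebra H) (c d : ι → H) : Prop where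
  summable : Summable fun i ↦ ‖c i‖ * ‖d i‖
  nonneg : ∀ x ∈ M, 0 ≤ x → 0 ≤ seriesFunctional c d x
  faithful : ∀ x ∈ M, 0 ≤ x → seriesFunctional c d x = 0 → x = 0

/-- The operator `X` commutes with `M' ⊗ 1` and `1 ⊗ N'`. -/
def CommutesWithCommutants (M : VonNeumannAlgebra H) (N : VonNeumannAlgebra K)
    (X : HilbertTensor H K →L[ℂ] HilbertTensor H K) : Prop :=
  (∀ x ∈ M.commutant, Commute (tensorOp x 1) X) ∧ ∀ y ∈ N.commutant, Commute (tensorOp 1 y) X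

theorem mem_of_commute {M : VonNeumannAlgebra H} {z : H →L[ℂ] H}
    (h : ∀ x ∈ M.commutant, Commute x z) : z ∈ M := by
  rw [← M.commutant_commutant, mem_commutant_iff]
  exact fun x hx ↦ h x hx

theorem commute_of_mem_commutant {M : VonNeumannAlgebra H} {x z : H →L[ℂ] H}
    (hx : x ∈ M.commutant) (hz : z ∈ M) : Commute x z :=
  (mem_commutant_iff.1 hx z hz).symm

theorem exists_sqrt_mem {M : VonNeumannAlgebra H} {x : H →L[ℂ] H} (hx : x ∈ M) (h0 : 0 ≤ x) :
    ∃ s ∈ M, star s = s ∧ s * s = x := by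
  obtain ⟨s, hs1, hs2, hs3⟩ := exists_sqrt_of_nonneg h0
  exact ⟨s, mem_of_commute fun y hy ↦ (hs3 y (commute_of_mem_commutant hy hx).symm).symm, hs1, hs2⟩

theorem commutesWithCommutants_tensorOp {M : VonNeumannAlgebra H} {N : VonNeumannAlgebra K}
    {x : H →L[ℂ] H} {y : K →L[ℂ] K} (hx : x ∈ M) (hy : y ∈ N) :
    CommutesWithCommutants M N (tensorOp x y) := by
  refine ⟨fun x' hx' ↦ ?_, fun y' hy' ↦ ?_⟩
  · rw [commute_iff_eq, ← tensorOp_mul, ← tensorOp_mul, one_mul, mul_one,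
      (commute_of_mem_commutant hx' hx).eq]
  · rw [commute_iff_eq, ← tensorOp_mul, ← tensorOp_mul, one_mul, mul_one,
      (commute_of_mem_commutant hy' hy).eq]

section

variable {M : VonNeumannAlgebra H} {N : VonNeumannAlgebra K} {c d : ι → H} {a b : κ → K}
  {X : HilbertTensor H K →L[ℂ] HilbertTensor H K}

theorem CommutesWithCommutants.leftSlice_mem (hX : CommutesWithCommutants M N X) (ξ ξ' : H) :
    leftSlice ξ ξ' X ∈ N :=
  mem_of_commute fun y hy ↦ leftSlice_commute ξ ξ' (hX.2 y hy)

theorem CommutesWithCommutants.seriesSlice_mem (hX : CommutesWithCommutants M N X)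
    (h : Summable fun i ↦ ‖a i‖ * ‖b i‖) : seriesSlice H a b X ∈ M :=
  mem_of_commute fun x hx ↦ by
    rw [← (hasSum_seriesSlice h X).tsum_eq]
    exact Commute.tsum_right x fun i ↦ rightSlice_commute _ _ (hX.1 x hx)

theorem CommutesWithCommutants.seriesSlice_nonneg (hX : CommutesWithCommutants M N X) (h0 : 0 ≤ X)
    (hab : IsFaithfulSeries N a b) : 0 ≤ seriesSlice H a b X :=
  nonneg_of_inner_nonneg fun ξ ↦ by
    rw [inner_seriesSlice hab.summable]
    exact hab.nonneg _ (hX.leftSlice_mem ξ ξ) (leftSlice_nonneg ξ h0)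

theorem productFunctional_nonneg (hX : CommutesWithCommutants M N X) (h0 : 0 ≤ X)
    (hcd : IsFaithfulSeries M c d) (hab : IsFaithfulSeries N a b) :
    0 ≤ productFunctional c d a b X :=
  hcd.nonneg _ (hX.seriesSlice_mem hab.summable) (hX.seriesSlice_nonneg h0 hab)

/-- The product of faithful normal functionals is faithful. -/
theorem eq_zero_of_productFunctional_eq_zero (hX : CommutesWithCommutants M N X) (h0 : 0 ≤ X)
    (hcd : IsFaithfulSeries M c d) (hab : IsFaithfulSeries N a b)
    (h : productFunctional c d a b X = 0) : X = 0 := by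
  -- Faithfulness on `M` kills the slice; faithfulness on `N` then kills each diagonal slice over
  -- the first factor.
  have h1 : seriesSlice H a b X = 0 :=
    hcd.faithful _ (hX.seriesSlice_mem hab.summable) (hX.seriesSlice_nonneg h0 hab) h
  refine eq_zero_of_inner_pureTensor_eq_zero h0 fun ξ η ↦ ?_
  have h2 := inner_seriesSlice hab.summable X ξ ξ
  rw [h1, zero_apply, inner_zero_right] at h2
  have h3 := hab.faithful _ (hX.leftSlice_mem ξ ξ) (leftSlice_nonneg ξ h0) h2.symm
  rw [← inner_leftSlice, h3, zero_apply, inner_zero_right]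

end

end VonNeumannAlgebra

/-- A functional that is continuous for the ultraweak topology is given by a series. -/
theorem exists_series_of_ultraweak_continuous (M : VonNeumannAlgebra H)
    (τ : M.toStarSubalgebra →ₗ[ℂ] ℂ)
    (hτ : @Continuous _ _ (TopologicalSpace.induced Subtype.val (ultraweakTopology H))
      inferInstance τ) :
    ∃ (ι : Type) (c d : ι → H), (Summable fun i ↦ ‖c i‖ * ‖d i‖) ∧
      ∀ x : M.toStarSubalgebra, seriesFunctional c d (x : H →L[ℂ] H) = τ x := by
  let f : lp (fun _ : ℕ ↦ H) 2 × lp (fun _ : ℕ ↦ H) 2 → M.toStarSubalgebra →ₗ[ℂ] ℂ := fun p ↦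
    (seriesFunctional p.2 p.1).toLinearMap ∘ₗ M.toStarSubalgebra.subtype.toLinearMap
  have hsum : ∀ p : lp (fun _ : ℕ ↦ H) 2 × lp (fun _ : ℕ ↦ H) 2,
      Summable fun n ↦ ‖p.2 n‖ * ‖p.1 n‖ := by
    intro p
    have h1 : ∀ q : lp (fun _ : ℕ ↦ H) 2, Summable fun n ↦ ‖q n‖ ^ 2 := fun q ↦ by
      simpa using (lp.memℓp q).summable (by norm_num)
    refine Summable.of_nonneg_of_le (fun n ↦ by positivity) (fun n ↦ ?_) ((h1 p.2).add (h1 p.1))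
    nlinarith [sq_nonneg (‖p.2 n‖ - ‖p.1 n‖), sq_nonneg (‖p.2 n‖), sq_nonneg (‖p.1 n‖)]
  -- A linear functional continuous for the initial topology of a family of functionals lies in the
  -- linear span of that family; sums are then absorbed by joining index sets.
  have hmem : τ ∈ Submodule.span ℂ (Set.range f) := by
    rw [LinearMap.mem_span_iff_continuous]
    convert hτ using 1
    rw [ultraweakTopology, induced_iInf, iInf_prod]
    refine iInf_congr fun ξ ↦ ?_
    rw [induced_iInf]
    refine iInf_congr fun η ↦ ?_
    rw [induced_compose]
    congr 1
    ext x
    exact (hasSum_seriesFunctional (hsum (ξ, η)) _).tsum_eq.symm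
  clear hτ
  induction hmem using Submodule.span_induction with
  | mem σ hσ =>
    obtain ⟨p, rfl⟩ := hσ
    exact ⟨ℕ, p.2, p.1, hsum p, fun x ↦ rfl⟩
  | zero =>
    exact ⟨Empty, Empty.elim, Empty.elim, summable_empty, fun x ↦ by simp [seriesFunctional, operatorSeries]⟩
  | add σ σ' _ _ h h' =>
    obtain ⟨ι, c, d, hs, hcd⟩ := h
    obtain ⟨ι', c', d', hs', hcd'⟩ := h'
    have hss : Summable fun i ↦ ‖Sum.elim c c' i‖ * ‖Sum.elim d d' i‖ :=
      Summable.sum _ hs hs'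
    refine ⟨ι ⊕ ι', Sum.elim c c', Sum.elim d d', hss, fun x ↦ ?_⟩
    rw [LinearMap.add_apply, ← hcd, ← hcd']
    refine (hasSum_seriesFunctional hss _).unique ?_
    exact HasSum.sum (hasSum_seriesFunctional hs _) (hasSum_seriesFunctional hs' _)
  | smul r σ _ h =>
    obtain ⟨ι, c, d, hs, hcd⟩ := h
    have hss : Summable fun i ↦ ‖c i‖ * ‖r • d i‖ := by
      refine (hs.mul_left ‖r‖).congr fun i ↦ ?_
      rw [norm_smul]
      ring
    refine ⟨ι, c, fun i ↦ r • d i, hss, fun x ↦ ?_⟩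
    rw [LinearMap.smul_apply, ← hcd]
    refine (hasSum_seriesFunctional hss _).unique ?_
    simp only [map_smul, inner_smul_right]
    exact (hasSum_seriesFunctional hs _).mul_left r

end SeriesFunctional

/-! ### Representations of groups and moments of self-adjoint operators -/

section GroupRepresentation

variable {Γ : Type*} [Group Γ] {E : Type*} [NormedAddCommGroup E] [InnerProductSpace ℂ E]

/-- The extension of a homomorphism into the bounded operators to the real group algebra. -/
noncomputable def evalRep (π : Γ →* (E →L[ℂ] E)) : MonoidAlgebra ℝ Γ →ₐ[ℝ] (E →L[ℂ] E) :=
  MonoidAlgebra.lift ℝ (E →L[ℂ] E) Γ π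

theorem evalRep_single (π : Γ →* (E →L[ℂ] E)) (g : Γ) (a : ℝ) :
    evalRep π (MonoidAlgebra.single g a) = a • π g := MonoidAlgebra.lift_single _ _ _

variable {π : Γ →* (E →L[ℂ] E)} {Φ : (E →L[ℂ] E) →L[ℂ] ℂ} {φ : Γ → ℝ}

theorem apply_evalRep (h : ∀ g, Φ (π g) = φ g) (P : MonoidAlgebra ℝ Γ) :
    Φ (evalRep π P) = MonoidAlgebra.eval φ P := by
  induction P using MonoidAlgebra.induction_linear with
  | zero => simp
  | add x y hx hy => simp only [map_add, hx, hy, Complex.ofReal_add]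
  | single g a =>
    rw [evalRep_single, ← Complex.coe_smul, map_smul, h, MonoidAlgebra.eval_single, smul_eq_mul,
      Complex.ofReal_mul]

/-- `S` plays the part of π(P)*: replace every `g` in `P` by `g⁻¹`. Only the multiplicativity of π
is needed. -/
theorem exists_form_eq (h : ∀ g, Φ (π g) = φ g) (P : MonoidAlgebra ℝ Γ) :
    ∃ S : E →L[ℂ] E, ∀ Q, (MonoidAlgebra.form φ P Q : ℂ) = Φ (S * evalRep π Q) := by
  induction P using MonoidAlgebra.induction_linear with
  | zero => exact ⟨0, fun Q ↦ by simp⟩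
  | add x y hx hy =>
    obtain ⟨S, hS⟩ := hx
    obtain ⟨S', hS'⟩ := hy
    exact ⟨S + S', fun Q ↦ by
      rw [map_add, LinearMap.add_apply, Complex.ofReal_add, hS, hS', add_mul, map_add]⟩
  | single g a =>
    refine ⟨evalRep π (MonoidAlgebra.single g⁻¹ a), fun Q ↦ ?_⟩
    rw [← map_mul, apply_evalRep h]
    congr 1
    induction Q using MonoidAlgebra.induction_linear with
    | zero => simp
    | add x y hx hy => simp only [map_add, mul_add, hx, hy]
    | single g' b =>
      rw [MonoidAlgebra.form_single_single, MonoidAlgebra.single_mul_single,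
        MonoidAlgebra.eval_single, mul_assoc]

/-- Boundedness of Φ and submultiplicativity of the norm give the growth hypothesis of
`FreeGroup.kesten` with ρ the operator norm. -/
theorem form_one_add_pow_le (h : ∀ g, Φ (π g) = φ g) (A f : MonoidAlgebra ℝ Γ) :
    ∃ C, ∀ n, MonoidAlgebra.form φ f ((1 + A) ^ n * f) ≤ C * (1 + ‖evalRep π A‖) ^ n := by
  obtain ⟨S, hS⟩ := exists_form_eq h f
  have hpow : ∀ n, ‖(1 + evalRep π A) ^ n‖ ≤ (1 + ‖evalRep π A‖) ^ n := by
    intro n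
    induction n with
    | zero =>
      rw [pow_zero, pow_zero]
      exact ContinuousLinearMap.norm_id_le
    | succ n ih =>
      rw [pow_succ, pow_succ]
      refine (norm_mul_le _ _).trans (mul_le_mul ih ?_ (norm_nonneg _) (by positivity))
      exact (norm_add_le _ _).trans (add_le_add_left ContinuousLinearMap.norm_id_le _)
  refine ⟨‖Φ‖ * (‖S‖ * ‖evalRep π f‖), fun n ↦ ?_⟩
  calc MonoidAlgebra.form φ f ((1 + A) ^ n * f)
      ≤ ‖(MonoidAlgebra.form φ f ((1 + A) ^ n * f) : ℂ)‖ := by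
        rw [Complex.norm_real]; exact le_abs_self _
    _ = ‖Φ (S * ((1 + evalRep π A) ^ n * evalRep π f))‖ := by
        rw [hS, map_mul (evalRep π), map_pow (evalRep π), map_add (evalRep π), map_one (evalRep π)]
    _ ≤ ‖Φ‖ * (‖S‖ * ((1 + ‖evalRep π A‖) ^ n * ‖evalRep π f‖)) := by
        refine (Φ.le_opNorm _).trans (mul_le_mul_of_nonneg_left ?_ (norm_nonneg _))
        refine (norm_mul_le _ _).trans (mul_le_mul_of_nonneg_left ?_ (norm_nonneg _))
        exact (norm_mul_le _ _).trans (mul_le_mul_of_nonneg_right (hpow n) (norm_nonneg _))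
    _ = _ := by ring

end GroupRepresentation

/-- The norm of a self-adjoint operator is bounded by the growth rate of its moments for a
functional that is positive and faithful on the bicommutant of the operator. -/
theorem IsSelfAdjoint.norm_le_of_moments {E : Type*} [NormedAddCommGroup E]
    [InnerProductSpace ℂ E] [CompleteSpace E] {T : E →L[ℂ] E} (hT : IsSelfAdjoint T)
    (Φ : (E →L[ℂ] E) →L[ℂ] ℂ)
    (hΦ : ∀ X, 0 ≤ X → (∀ Y, Commute Y T → Commute Y X) → 0 ≤ Φ X ∧ (Φ X = 0 → X = 0))
    {ρ : ℝ} (hρ : 0 ≤ ρ) (hm : ∀ n, ‖Φ (T ^ n)‖ ≤ ρ ^ n) : ‖T‖ ≤ ρ := by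
  refine le_of_forall_gt_imp_ge_of_dense fun s hs ↦ ?_
  have hs0 : 0 < s := hρ.trans_lt hs
  -- `f` detects the spectrum outside [-s, s]; the aim is f(T) = 0.
  set f : ℝ → ℝ := fun t ↦ max 0 (t ^ 2 - s ^ 2) with hf
  have hfc : Continuous f := by fun_prop
  have hcomm : ∀ g : ℝ → ℝ, ∀ Y, Commute Y T → Commute Y (cfc g T) := fun g Y hY ↦
    (hY.symm.cfc_real g).symm
  have hspec : ∀ t ∈ spectrum ℝ T, |t| ≤ ‖T‖ := by
    have h1 : ‖cfc (fun t : ℝ ↦ t) T‖ ≤ ‖T‖ := by rw [cfc_id' ℝ T]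
    exact (norm_cfc_le_iff (fun t : ℝ ↦ t) T (norm_nonneg T)).1 h1
  have hp0 : 0 ≤ cfc f T := cfc_nonneg fun t _ ↦ le_max_left _ _
  obtain ⟨h1, h2⟩ := hΦ _ hp0 (hcomm f)
  have hbound : ∀ n : ℕ, ‖Φ (cfc f T)‖ ≤ ‖T‖ ^ 2 * ((ρ / s) ^ 2) ^ n := by
    intro n
    set r : ℝ := ‖T‖ ^ 2 * (s ^ (2 * n))⁻¹ with hr
    have hr0 : 0 ≤ r := by positivity
    have hq : cfc (fun t : ℝ ↦ r * t ^ (2 * n)) T = (r : ℂ) • T ^ (2 * n) := by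
      rw [cfc_const_mul r (fun t ↦ t ^ (2 * n)) T, cfc_pow_id T (2 * n), Complex.coe_smul]
    -- On the spectrum f(t) ≤ ‖T‖² (t/s)^(2n): where t² ≥ s² the power is at least 1, and elsewhere
    -- f vanishes. Applying Φ gives the decay (ρ/s)^(2n).
    have hle : cfc f T ≤ (r : ℂ) • T ^ (2 * n) := by
      rw [← hq]
      refine cfc_mono fun t ht ↦ max_le ?_ ?_
      · rw [pow_mul]; positivity
      · rcases le_total (t ^ 2) (s ^ 2) with h | h
        · have : 0 ≤ r * t ^ (2 * n) := by rw [pow_mul]; positivity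
          linarith
        · have h3 : t ^ 2 ≤ ‖T‖ ^ 2 := sq_le_sq' (abs_le.1 (hspec t ht)).1 (abs_le.1 (hspec t ht)).2
          have h4 : 1 ≤ (s ^ (2 * n))⁻¹ * t ^ (2 * n) := by
            rw [inv_mul_eq_div, one_le_div (by positivity), pow_mul, pow_mul]
            exact pow_le_pow_left₀ (by positivity) h n
          rw [hr, mul_assoc]
          nlinarith [sq_nonneg ‖T‖, sq_nonneg s]
    have hnn := (hΦ ((r : ℂ) • T ^ (2 * n) - cfc f T) (sub_nonneg.2 hle) fun Y hY ↦
      ((hY.pow_right _).smul_right _).sub_right (hcomm f Y hY)).1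
    rw [map_sub, sub_nonneg, map_smul] at hnn
    calc ‖Φ (cfc f T)‖ ≤ ‖(r : ℂ) • Φ (T ^ (2 * n))‖ :=
          CStarAlgebra.norm_le_norm_of_nonneg_of_le h1 hnn
      _ ≤ r * ρ ^ (2 * n) := by
          rw [norm_smul, Complex.norm_real, Real.norm_of_nonneg hr0]
          exact mul_le_mul_of_nonneg_left (hm _) hr0
      _ = _ := by
          rw [hr, div_pow, div_pow, pow_mul, pow_mul]
          field_simp
  have hlim : Filter.Tendsto (fun n : ℕ ↦ ‖T‖ ^ 2 * ((ρ / s) ^ 2) ^ n) Filter.atTop (nhds 0) := by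
    have h3 : (ρ / s) ^ 2 < 1 := by
      rw [sq_lt_one_iff₀ (by positivity), div_lt_one hs0]
      exact hs
    simpa using (tendsto_pow_atTop_nhds_zero_of_lt_one (by positivity) h3).const_mul (‖T‖ ^ 2)
  have hz : cfc f T = 0 := h2 (norm_le_zero_iff.1 (ge_of_tendsto' hlim hbound))
  have hz' : cfc f T = cfc (fun _ : ℝ ↦ (0 : ℝ)) T := by rw [hz, cfc_const_zero]
  have heq := eqOn_of_cfc_eq_cfc hz'
  rw [← cfc_id' ℝ T]
  refine norm_cfc_le hs0.le fun t ht ↦ abs_le_of_sq_le_sq ?_ hs0.le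
  have := (le_max_right 0 (t ^ 2 - s ^ 2)).trans_eq (heq ht)
  linarith

/-! ### Freeness and vanishing of the trace on reduced words -/

section Freeness

variable {A : Type*} [Ring A] [Algebra ℂ A] [StarRing A] [StarModule ℂ A] {τ : A →ₗ[ℂ] ℂ}
  {ι : Type*} {u : ι → unitary A}

/-- The integer powers of a unitary span the *-algebra it generates. -/
theorem StarAlgebra.adjoin_singleton_unitary_le (v : unitary A) {a : A}
    (ha : a ∈ StarAlgebra.adjoin ℂ {(v : A)}) :
    a ∈ Submodule.span ℂ (Set.range fun k : ℤ ↦ ((v ^ k : unitary A) : A)) := by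
  have hmul : ∀ a b, a ∈ Submodule.span ℂ (Set.range fun k : ℤ ↦ ((v ^ k : unitary A) : A)) →
      b ∈ Submodule.span ℂ (Set.range fun k : ℤ ↦ ((v ^ k : unitary A) : A)) →
      a * b ∈ Submodule.span ℂ (Set.range fun k : ℤ ↦ ((v ^ k : unitary A) : A)) := by
    intro a b ha hb
    have := Submodule.mul_mem_mul ha hb
    rw [Submodule.span_mul_span] at this
    refine Submodule.span_mono ?_ this
    rintro _ ⟨_, ⟨k, rfl⟩, _, ⟨l, rfl⟩, rfl⟩
    exact ⟨k + l, by simp [zpow_add]⟩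
  induction ha using StarAlgebra.adjoin_induction with
  | mem x hx =>
    obtain rfl := hx
    exact Submodule.subset_span ⟨1, by simp⟩
  | algebraMap r =>
    rw [Algebra.algebraMap_eq_smul_one]
    exact Submodule.smul_mem _ _ (Submodule.subset_span ⟨0, by simp⟩)
  | add x y _ _ hx hy => exact Submodule.add_mem _ hx hy
  | mul x y _ _ hx hy => exact hmul _ _ hx hy
  | star x hx' hx =>
    clear hx'
    induction hx using Submodule.span_induction with
    | mem y hy =>
      obtain ⟨k, rfl⟩ := hy
      exact Submodule.subset_span ⟨-k, by
        simp only [zpow_neg, ← Unitary.star_eq_inv, Unitary.coe_star]⟩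
    | zero => rw [star_zero]; exact Submodule.zero_mem _
    | add x y _ _ hx hy => rw [star_add]; exact Submodule.add_mem _ hx hy
    | smul c x _ hx => rw [star_smul]; exact Submodule.smul_mem _ _ hx

theorem StarAlgebra.zpow_mem_adjoin_singleton (v : unitary A) (k : ℤ) :
    ((v ^ k : unitary A) : A) ∈ StarAlgebra.adjoin ℂ {(v : A)} := by
  have hv : (v : A) ∈ StarAlgebra.adjoin ℂ {(v : A)} := StarAlgebra.self_mem_adjoin_singleton ℂ _
  cases k with
  | ofNat n =>
    rw [Int.ofNat_eq_natCast, zpow_natCast, SubmonoidClass.coe_pow]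
    exact pow_mem hv n
  | negSucc n =>
    rw [zpow_negSucc, ← Unitary.star_eq_inv, Unitary.coe_star, SubmonoidClass.coe_pow]
    exact star_mem (pow_mem hv _)

/-- For a Haar unitary, τ reads off the coefficient of the zeroth power, so subtracting τ(b)·1
leaves only nonzero powers. -/
theorem mem_span_zpow_of_trace_eq_zero (h1 : τ 1 = 1) {v : unitary A} (hv : IsHaarUnitary τ v)
    {a : A} (ha : a ∈ StarAlgebra.adjoin ℂ {(v : A)}) (h0 : τ a = 0) :
    a ∈ Submodule.span ℂ ((fun k : ℤ ↦ ((v ^ k : unitary A) : A)) '' {0}ᶜ) := by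
  have key : ∀ b ∈ Submodule.span ℂ (Set.range fun k : ℤ ↦ ((v ^ k : unitary A) : A)),
      b - τ b • (1 : A) ∈
        Submodule.span ℂ ((fun k : ℤ ↦ ((v ^ k : unitary A) : A)) '' {0}ᶜ) := by
    intro b hb
    induction hb using Submodule.span_induction with
    | mem y hy =>
      obtain ⟨k, rfl⟩ := hy
      by_cases hk : k = 0
      · subst hk
        simp [h1]
      · simp only [hv k hk, zero_smul, sub_zero]
        exact Submodule.subset_span ⟨k, hk, rfl⟩
    | zero => simp
    | add x y _ _ hx hy =>
      convert Submodule.add_mem _ hx hy using 1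
      rw [map_add, add_smul]
      abel
    | smul c x _ hx =>
      convert Submodule.smul_mem _ c hx using 1
      rw [map_smul, smul_sub, smul_smul, smul_eq_mul]
  have := key a (StarAlgebra.adjoin_singleton_unitary_le v ha)
  rwa [h0, zero_smul, sub_zero] at this

/-- The product of a list of linear combinations is a linear combination of products. -/
theorem prod_mem_span_of_mem_span {κ : Type*} {v : ι → κ → A} {S : Set κ} (l : List (ι × A))
    (h : ∀ p ∈ l, p.2 ∈ Submodule.span ℂ (v p.1 '' S)) :
    (l.map Prod.snd).prod ∈ Submodule.span ℂ
      {a | ∃ l' : List (ι × κ), l'.map Prod.fst = l.map Prod.fst ∧ (∀ p ∈ l', p.2 ∈ S) ∧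
        (l'.map fun p ↦ v p.1 p.2).prod = a} := by
  induction l with
  | nil => exact Submodule.subset_span ⟨[], rfl, by simp, rfl⟩
  | cons p l ih =>
    have h1 := Submodule.mul_mem_mul (h p List.mem_cons_self)
      (ih fun q hq ↦ h q (List.mem_cons_of_mem _ hq))
    rw [Submodule.span_mul_span] at h1
    rw [List.map_cons (f := Prod.snd), List.prod_cons]
    refine Submodule.span_mono ?_ h1
    rintro _ ⟨_, ⟨k, hk, rfl⟩, _, ⟨l', hl1, hl2, rfl⟩, rfl⟩
    refine ⟨(p.1, k) :: l', by simp [hl1], ?_, by simp⟩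
    rintro q hq
    rcases List.mem_cons.1 hq with rfl | hq
    · exact hk
    · exact hl2 q hq

/-- The factors of a free product of infinite cyclic groups. -/
theorem FreeGroup.of_unit_zpow_surjective (x : FreeGroup Unit) :
    ∃ k : ℤ, x = FreeGroup.of () ^ k :=
  ⟨FreeGroup.freeGroupUnitEquivInt x, (FreeGroup.freeGroupUnitEquivInt.left_inv x).symm⟩

/-- View the free group as a free product of infinite cyclic groups; the list is then a nonempty
reduced word, and normal forms are unique. -/
theorem FreeGroup.prod_of_zpow_ne_one (l : List (ι × ℤ)) (hl : l ≠ [])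
    (hc : (l.map Prod.fst).IsChain (· ≠ ·)) (h0 : ∀ p ∈ l, p.2 ≠ 0) :
    (l.map fun p ↦ FreeGroup.of p.1 ^ p.2).prod ≠ 1 := by
  classical
  let w : Monoid.CoprodI.Word fun _ : ι ↦ FreeGroup Unit :=
    { toList := l.map fun p ↦ ⟨p.1, FreeGroup.of () ^ p.2⟩
      ne_one := by
        intro q hq
        obtain ⟨p, hp, rfl⟩ := List.mem_map.1 hq
        intro h
        have h1 := congrArg (FreeGroup.lift fun _ ↦ Multiplicative.ofAdd (1 : ℤ)) h
        rw [map_zpow, FreeGroup.lift_apply_of, MonoidHom.map_one, ← ofAdd_zsmul, ofAdd_eq_one] at h1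
        exact h0 p hp (by simpa using h1)
      chain_ne := by
        rw [List.isChain_map] at hc ⊢
        exact hc }
  intro h
  have h2 : w.prod = freeGroupEquivCoprodI (l.map fun p ↦ FreeGroup.of p.1 ^ p.2).prod := by
    rw [map_list_prod, List.map_map, Monoid.CoprodI.Word.prod, List.map_map]
    congr 1
    refine List.map_congr_left fun p _ ↦ ?_
    simp
  rw [h, _root_.map_one, ← Monoid.CoprodI.Word.prod_empty] at h2
  have h3 : w = Monoid.CoprodI.Word.empty := Monoid.CoprodI.Word.equiv.symm.injective h2
  exact hl (List.map_eq_nil_iff.1 (congrArg Monoid.CoprodI.Word.toList h3))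

theorem FreeGroup.exists_prod_of_zpow (g : FreeGroup ι) (hg : g ≠ 1) :
    ∃ l : List (ι × ℤ), l ≠ [] ∧ (l.map Prod.fst).IsChain (· ≠ ·) ∧ (∀ p ∈ l, p.2 ≠ 0) ∧
      g = (l.map fun p ↦ FreeGroup.of p.1 ^ p.2).prod := by
  classical
  set w := Monoid.CoprodI.Word.equiv (freeGroupEquivCoprodI g) with hw
  have hwp : w.prod = freeGroupEquivCoprodI g := Monoid.CoprodI.Word.equiv.symm_apply_apply _
  choose k hk using FreeGroup.of_unit_zpow_surjective
  refine ⟨w.toList.map fun p ↦ (p.1, k p.2), ?_, ?_, ?_, ?_⟩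
  · intro h
    have h1 : w = Monoid.CoprodI.Word.empty :=
      Monoid.CoprodI.Word.ext (List.map_eq_nil_iff.1 h)
    rw [h1, Monoid.CoprodI.Word.prod_empty] at hwp
    exact hg ((map_eq_one_iff _ freeGroupEquivCoprodI.injective).1 hwp.symm)
  · have := w.chain_ne
    rw [List.isChain_map, List.isChain_map]
    exact this
  · intro p hp
    obtain ⟨q, hq, rfl⟩ := List.mem_map.1 hp
    intro h0
    refine w.ne_one q hq ?_
    rw [hk q.2]
    change k q.2 = 0 at h0
    rw [h0, zpow_zero]
  · apply freeGroupEquivCoprodI.injective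
    rw [← hwp, map_list_prod, List.map_map, List.map_map, Monoid.CoprodI.Word.prod]
    congr 1
    refine List.map_congr_left fun p _ ↦ ?_
    conv_lhs => rw [hk p.2]
    simp

/-- Unitaries are free Haar unitaries if and only if the trace vanishes on the nontrivial words. -/
theorem areFreeHaarUnitaries_iff (h1 : τ 1 = 1) :
    AreFreeHaarUnitaries τ u ↔ ∀ g : FreeGroup ι, g ≠ 1 → τ (FreeGroup.lift u g : unitary A) = 0 := by
  have hword : ∀ l : List (ι × ℤ),
      ((FreeGroup.lift u (l.map fun p ↦ FreeGroup.of p.1 ^ p.2).prod : unitary A) : A) =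
        (l.map fun p ↦ ((u p.1 ^ p.2 : unitary A) : A)).prod := by
    intro l
    induction l with
    | nil => simp
    | cons p l ih => simp only [List.map_cons, List.prod_cons, map_mul, map_zpow,
        FreeGroup.lift_apply_of, Submonoid.coe_mul, ih]
  constructor
  · rintro ⟨hH, hF⟩ g hg
    obtain ⟨l, hl, hc, h0, rfl⟩ := FreeGroup.exists_prod_of_zpow g hg
    rw [hword]
    have := hF (l.map fun p ↦ (p.1, ((u p.1 ^ p.2 : unitary A) : A))) (by simpa using hl)
      (by rw [List.map_map]; exact hc) ?_
    · rwa [List.map_map] at this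
    · intro p hp
      obtain ⟨q, hq, rfl⟩ := List.mem_map.1 hp
      refine ⟨?_, hH q.1 q.2 (h0 q hq)⟩
      exact StarAlgebra.zpow_mem_adjoin_singleton _ _
  · intro h
    have hH : ∀ i, IsHaarUnitary τ (u i) := fun i k hk ↦ by
      have := h _ (FreeGroup.prod_of_zpow_ne_one [(i, k)] (by simp) (by simp) (by simpa using hk))
      rw [hword] at this
      simpa using this
    refine ⟨hH, fun l hl hc hp ↦ ?_⟩
    have hspan := prod_mem_span_of_mem_span (v := fun i (k : ℤ) ↦ ((u i ^ k : unitary A) : A))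
      l fun p hpl ↦ mem_span_zpow_of_trace_eq_zero h1 (hH p.1) (hp p hpl).1 (hp p hpl).2
    -- By multilinearity it suffices to treat alternating products of nonzero powers, which are
    -- nontrivial words.
    refine (Submodule.span_le (p := LinearMap.ker τ)).2 ?_ hspan
    rintro _ ⟨l', hl1, hl2, rfl⟩
    have hl' : l' ≠ [] := by
      rintro rfl
      exact hl (List.map_eq_nil_iff.1 hl1.symm)
    have := h _ (FreeGroup.prod_of_zpow_ne_one l' hl' (hl1 ▸ hc) hl2)
    rwa [hword] at this

end Freeness

/-! ### The opposite algebra and traces -/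

section Trace

variable {H : Type*} [NormedAddCommGroup H] [InnerProductSpace ℂ H] [CompleteSpace H]
  {M : VonNeumannAlgebra H} {τ : M.toStarSubalgebra →ₗ[ℂ] ℂ}

theorem inner_riesz_transposeOp (x : H →L[ℂ] H) (η ξ : H) :
    ⟪riesz H ξ, transposeOp x (riesz H η)⟫_ℂ = ⟪η, x ξ⟫_ℂ := by
  rw [dual_inner_def, LinearIsometryEquiv.symm_apply_apply, inner_riesz_symm, transposeOp_apply,
    riesz_apply]

/-- The Riesz map is conjugate-linear, so the two vectors of each functional change places under
transposition. -/
theorem seriesFunctional_transposeOp {ι : Type*} {c d : ι → H}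
    (h : Summable fun i ↦ ‖c i‖ * ‖d i‖) (x : H →L[ℂ] H) :
    seriesFunctional (fun i ↦ riesz H (d i)) (fun i ↦ riesz H (c i)) (transposeOp x) =
      seriesFunctional c d x := by
  refine (hasSum_seriesFunctional ?_ _).unique ?_
  · simpa only [LinearIsometryEquiv.norm_map, mul_comm] using h
  · simpa only [inner_riesz_transposeOp] using hasSum_seriesFunctional h x

theorem VonNeumannAlgebra.IsFaithfulSeries.opposite {ι : Type*} {c d : ι → H}
    (h : IsFaithfulSeries M c d) :
    IsFaithfulSeries M.opposite (fun i ↦ riesz H (d i)) (fun i ↦ riesz H (c i)) := by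
  have hpos : ∀ x : H →L[ℂ] H, 0 ≤ transposeOp x → 0 ≤ x := fun x hx ↦
    nonneg_of_inner_nonneg fun ξ ↦ by
      rw [← inner_riesz_transposeOp]
      exact ((ContinuousLinearMap.nonneg_iff_isPositive _).1 hx).inner_nonneg_right _
  refine ⟨?_, ?_, ?_⟩
  · simpa only [LinearIsometryEquiv.norm_map, mul_comm] using h.summable
  · rintro _ ⟨x, hx, rfl⟩ h0
    rw [seriesFunctional_transposeOp h.summable]
    exact h.nonneg x hx (hpos x h0)
  · rintro _ ⟨x, hx, rfl⟩ h0 hz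
    rw [seriesFunctional_transposeOp h.summable] at hz
    rw [h.faithful x hx (hpos x h0) hz]
    ext f ξ
    exact ContinuousLinearMap.map_zero (f : StrongDual ℂ H)

namespace IsFaithfulNormalTrace

/-- A positive element of `M` is s*s with its square root `s` in `M`, so positivity and faithfulness
of τ pass to the series. -/
theorem exists_isFaithfulSeries (hτ : IsFaithfulNormalTrace M τ) :
    ∃ (ι : Type) (c d : ι → H), M.IsFaithfulSeries c d ∧
      ∀ x : M.toStarSubalgebra, seriesFunctional c d (x : H →L[ℂ] H) = τ x := by
  obtain ⟨ι, c, d, hs, h⟩ := exists_series_of_ultraweak_continuous M τ hτ.normal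
  refine ⟨ι, c, d, ⟨hs, fun x hx h0 ↦ ?_, fun x hx h0 hz ↦ ?_⟩, h⟩
  · obtain ⟨s, hs, hsa, rfl⟩ := VonNeumannAlgebra.exists_sqrt_mem hx h0
    have h1 := hτ.nonneg ⟨s, hs⟩
    rw [← h] at h1
    change 0 ≤ seriesFunctional c d (star s * s) at h1
    rwa [hsa] at h1
  · obtain ⟨s, hs, hsa, rfl⟩ := VonNeumannAlgebra.exists_sqrt_mem hx h0
    have h1 := hτ.faithful ⟨s, hs⟩
    rw [← h] at h1
    change seriesFunctional c d (star s * s) = 0 → _ at h1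
    rw [hsa] at h1
    have h2 : s = 0 := congrArg Subtype.val (h1 hz)
    rw [h2, mul_zero]

theorem map_star (hτ : IsFaithfulNormalTrace M τ) (x : M.toStarSubalgebra) :
    τ (star x) = star (τ x) := by
  have him : ∀ y, (τ (star y * y)).im = 0 := fun y ↦ (Complex.nonneg_iff.1 (hτ.nonneg y)).2.symm
  -- Polarization: reality of τ at these two squares fixes the imaginary and real parts of τ(x*).
  have h1 := him (1 + x)
  have h2 := him (1 + Complex.I • x)
  have h3 := him x
  simp only [star_add, star_one, star_smul, add_mul, mul_add, one_mul, mul_one, map_add, map_smul,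
    smul_mul_assoc, mul_smul_comm, Complex.star_def, Complex.conj_I, hτ.map_one,
    smul_eq_mul, Complex.add_im, Complex.mul_im, Complex.neg_re, Complex.neg_im, Complex.I_re,
    Complex.I_im, Complex.one_im, Complex.mul_re, h3] at h1 h2
  refine Complex.ext ?_ ?_
  · rw [Complex.star_def, Complex.conj_re]
    linarith
  · rw [Complex.star_def, Complex.conj_im]
    linarith

variable {Γ : Type*} [Group Γ]

/-- The quadratic form is τ(y*y) for y = ∑ x_g U g. -/
theorem posSemidef_of_unitary (hτ : IsFaithfulNormalTrace M τ)
    (U : Γ →* unitary M.toStarSubalgebra) :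
    (Matrix.of fun g h : Γ ↦ τ (U (g⁻¹ * h) : unitary M.toStarSubalgebra)).PosSemidef := by
  refine ⟨?_, fun x ↦ ?_⟩
  · ext g h
    rw [Matrix.conjTranspose_apply, Matrix.of_apply, Matrix.of_apply, ← hτ.map_star,
      ← Unitary.coe_star, Unitary.star_eq_inv, ← map_inv, mul_inv_rev, inv_inv]
  · have h0 := hτ.nonneg (x.sum fun g a ↦ a • (U g : M.toStarSubalgebra))
    simp only [Finsupp.sum, star_sum, Finset.sum_mul_sum, map_sum, star_smul, smul_mul_smul_comm,
      map_smul] at h0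
    refine h0.trans_eq (Finset.sum_congr rfl fun g _ ↦ Finset.sum_congr rfl fun h _ ↦ ?_)
    have h1 : (U (g⁻¹ * h) : M.toStarSubalgebra) = star (U g : M.toStarSubalgebra) * U h := by
      rw [map_mul, map_inv, ← Unitary.star_eq_inv, Submonoid.coe_mul, Unitary.coe_star]
    change _ = star (x g) * τ (U (g⁻¹ * h) : M.toStarSubalgebra) * x h
    rw [h1, smul_eq_mul]
    ring

/-- The transpose of the positive semidefinite matrix τ(U(g⁻¹h)) is its entrywise conjugate; the
Schur product of the two has entries |τ(U(g⁻¹h))|². -/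
theorem isPosDefFun_normSq (hτ : IsFaithfulNormalTrace M τ)
    (U : Γ →* unitary M.toStarSubalgebra) :
    MonoidAlgebra.IsPosDefFun fun g ↦ Complex.normSq (τ (U g : unitary M.toStarSubalgebra)) := by
  have h1 := hτ.posSemidef_of_unitary U
  have h2 := h1.hadamard h1.transpose
  have h3 : ∀ g h : Γ, τ (U (h⁻¹ * g) : unitary M.toStarSubalgebra) =
      star (τ (U (g⁻¹ * h) : unitary M.toStarSubalgebra)) := fun g h ↦ by
    have := h1.1.apply h g
    exact this.symm
  refine ⟨?_, fun x ↦ ?_⟩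
  · ext g h
    change Complex.normSq (τ (U (h⁻¹ * g) : M.toStarSubalgebra)) =
      Complex.normSq (τ (U (g⁻¹ * h) : M.toStarSubalgebra))
    rw [h3, Complex.star_def, Complex.normSq_conj]
  · have h4 := h2.2 (x.mapRange (fun r : ℝ ↦ (r : ℂ)) Complex.ofReal_zero)
    rw [Finsupp.sum_mapRange_index (by simp)] at h4
    simp only [Finsupp.sum_mapRange_index, Matrix.hadamard_apply, Matrix.transpose_apply,
      Matrix.of_apply, mul_zero, implies_true] at h4
    rw [← Complex.zero_le_real]
    refine h4.trans_eq ?_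
    simp only [Finsupp.sum, Complex.ofReal_sum, Complex.ofReal_mul, Matrix.of_apply]
    refine Finset.sum_congr rfl fun g _ ↦ Finset.sum_congr rfl fun h _ ↦ ?_
    rw [h3 h g, Complex.star_def, Complex.normSq_conj, Complex.normSq_eq_conj_mul_self,
      star_trivial, Complex.conj_ofReal]

theorem normSq_conj (hτ : IsFaithfulNormalTrace M τ)
    (U : Γ →* unitary M.toStarSubalgebra) (g h : Γ) :
    Complex.normSq (τ (U (h * g * h⁻¹) : unitary M.toStarSubalgebra)) =
      Complex.normSq (τ (U g : unitary M.toStarSubalgebra)) := by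
  rw [map_mul, Submonoid.coe_mul, hτ.tracial, ← Submonoid.coe_mul, ← map_mul]
  simp

end IsFaithfulNormalTrace

end Trace

/-! ### The representation by `V_g ⊗ (V_g^op)*` -/

section TensorRepresentation

variable {H : Type*} [NormedAddCommGroup H] [InnerProductSpace ℂ H] [CompleteSpace H]
  {Γ : Type*} [Group Γ]

/-- The representation `g ↦ V_g ⊗ (V_g^op)*`. -/
noncomputable def tensorRep (V : Γ →* unitary (H →L[ℂ] H)) :
    Γ →* (HilbertTensor H (DualHilbert H) →L[ℂ] HilbertTensor H (DualHilbert H)) where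
  toFun g := tensorOp (V g : H →L[ℂ] H) (transposeOp (star (V g : H →L[ℂ] H)))
  map_one' := by
    rw [map_one, OneMemClass.coe_one, star_one, ← tensorOp_one]
    rfl
  map_mul' g h := by
    rw [map_mul, Submonoid.coe_mul, star_mul, transposeOp_mul, tensorOp_mul]

theorem tensorRep_apply (V : Γ →* unitary (H →L[ℂ] H)) (g : Γ) :
    tensorRep V g = tensorOp (V g : H →L[ℂ] H) (transposeOp (star (V g : H →L[ℂ] H))) := rfl

theorem star_tensorRep (V : Γ →* unitary (H →L[ℂ] H)) (g : Γ) :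
    star (tensorRep V g) = tensorRep V g⁻¹ := by
  rw [tensorRep_apply, star_tensorOp, ← transposeOp_star, tensorRep_apply, map_inv,
    ← Unitary.star_eq_inv, Unitary.coe_star]

variable {M : VonNeumannAlgebra H} {τ : M.toStarSubalgebra →ₗ[ℂ] ℂ}

/-- A unitary representation in `M` as a representation by unitary operators. -/
noncomputable def unitaryRep (U : Γ →* unitary M.toStarSubalgebra) : Γ →* unitary (H →L[ℂ] H) :=
  (Unitary.map (StarMonoidHom.ofClass M.toStarSubalgebra.subtype)).toMonoidHom.comp U

theorem unitaryRep_apply (U : Γ →* unitary M.toStarSubalgebra) (g : Γ) :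
    (unitaryRep U g : H →L[ℂ] H) = (U g : M.toStarSubalgebra) := rfl

theorem tensorRep_unitaryRep_apply (U : Γ →* unitary M.toStarSubalgebra)
    (g : Γ) :
    tensorRep (unitaryRep U) g =
      (VonNeumannAlgebra.tmul (N := M.opposite) (U g : M.toStarSubalgebra)
        (star (M.toOpposite (U g))) : (M.tensor M.opposite).toStarSubalgebra) := by
  rw [tensorRep_apply, unitaryRep_apply, transposeOp_star]
  rfl

theorem tensorRep_unitaryRep_inv_apply (U : Γ →* unitary M.toStarSubalgebra)
    (g : Γ) :
    tensorRep (unitaryRep U) g⁻¹ =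
      (VonNeumannAlgebra.tmul (N := M.opposite) (star (U g : M.toStarSubalgebra))
        (M.toOpposite (U g)) : (M.tensor M.opposite).toStarSubalgebra) := by
  rw [← star_tensorRep, tensorRep_apply, unitaryRep_apply, star_tensorOp, transposeOp_star,
    star_star]
  rfl

theorem commutesWithCommutants_tensorRep (U : Γ →* unitary M.toStarSubalgebra) (g : Γ) :
    VonNeumannAlgebra.CommutesWithCommutants M M.opposite (tensorRep (unitaryRep U) g) :=
  VonNeumannAlgebra.commutesWithCommutants_tensorOp (U g : M.toStarSubalgebra).2
    (M.toOpposite (star (U g : M.toStarSubalgebra))).2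

theorem productFunctional_tensorRep {ι : Type*} {c d : ι → H}
    (hs : Summable fun i ↦ ‖c i‖ * ‖d i‖) (hτ : IsFaithfulNormalTrace M τ)
    (h : ∀ x : M.toStarSubalgebra, seriesFunctional c d (x : H →L[ℂ] H) = τ x)
    (U : Γ →* unitary M.toStarSubalgebra) (g : Γ) :
    productFunctional c d (fun i ↦ riesz H (d i)) (fun i ↦ riesz H (c i))
        (tensorRep (unitaryRep U) g) =
      (Complex.normSq (τ (U g : unitary M.toStarSubalgebra)) : ℝ) := by
  have hs' : Summable fun i ↦ ‖riesz H (d i)‖ * ‖riesz H (c i)‖ := by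
    simpa only [LinearIsometryEquiv.norm_map, mul_comm] using hs
  have h1 := h (star (U g : M.toStarSubalgebra))
  rw [hτ.map_star] at h1
  rw [tensorRep_apply, productFunctional_tensorOp c d hs', seriesFunctional_transposeOp hs,
    unitaryRep_apply, h]
  refine (congrArg _ h1).trans ?_
  rw [Complex.star_def, Complex.mul_conj]

end TensorRepresentation

/-! ### The norm of the sum of the generators -/

theorem MonoidAlgebra.eval_regularChar {Γ : Type*} [Group Γ] (P : MonoidAlgebra ℝ Γ) :
    eval (regularChar Γ) P = P.coeff 1 := by
  classical
  rw [eval_apply]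
  simp only [regularChar, mul_ite, mul_one, mul_zero]
  rw [Finsupp.sum_ite_self_eq']

section FreeGroupRepresentation

variable {E : Type*} [NormedAddCommGroup E] [InnerProductSpace ℂ E] {Γ : Type*} [Group Γ]

theorem commute_evalRep {π : Γ →* (E →L[ℂ] E)} {Y : E →L[ℂ] E} (h : ∀ g, Commute Y (π g))
    (P : MonoidAlgebra ℝ Γ) : Commute Y (evalRep π P) := by
  induction P using MonoidAlgebra.induction_linear with
  | zero => rw [map_zero]; exact Commute.zero_right _
  | add x y hx hy => rw [map_add]; exact hx.add_right hy
  | single g a => rw [evalRep_single]; exact (h g).smul_right a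

theorem apply_evalRep_pow {π : Γ →* (E →L[ℂ] E)} {Φ : (E →L[ℂ] E) →L[ℂ] ℂ} {φ : Γ → ℝ}
    (h : ∀ g, Φ (π g) = φ g) (A : MonoidAlgebra ℝ Γ) (n : ℕ) :
    Φ (evalRep π A ^ n) = MonoidAlgebra.eval φ (A ^ n) := by
  rw [← map_pow (evalRep π), apply_evalRep h]

variable {α : Type*} [Fintype α]

theorem evalRep_letterSum (π : FreeGroup α →* (E →L[ℂ] E)) :
    evalRep π (FreeGroup.letterSum α) =
      ∑ i, (π (FreeGroup.of i) + π (FreeGroup.of i)⁻¹) := by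
  rw [FreeGroup.letterSum, map_sum, Fintype.sum_prod_type]
  refine Finset.sum_congr rfl fun i _ ↦ ?_
  rw [Fintype.sum_bool, evalRep_single, evalRep_single, one_smul, one_smul]
  rfl

theorem isSelfAdjoint_evalRep_letterSum [CompleteSpace E] {π : FreeGroup α →* (E →L[ℂ] E)}
    (h : ∀ g, star (π g) = π g⁻¹) : IsSelfAdjoint (evalRep π (FreeGroup.letterSum α)) := by
  rw [isSelfAdjoint_iff, evalRep_letterSum, star_sum]
  refine Finset.sum_congr rfl fun i _ ↦ ?_
  rw [star_add, h, h, inv_inv, add_comm]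

end FreeGroupRepresentation

/-! ### The norm criterion and the theorem -/

section Main

variable {H : Type*} [NormedAddCommGroup H] [InnerProductSpace ℂ H] [CompleteSpace H]
  {M : VonNeumannAlgebra H} {τ : M.toStarSubalgebra →ₗ[ℂ] ℂ} {α : Type*} [Fintype α]

theorem areFreeHaarUnitaries_iff_norm_eq (hτ : IsFaithfulNormalTrace M τ)
    (hα : 2 ≤ Fintype.card α) (u : α → unitary M.toStarSubalgebra) :
    AreFreeHaarUnitaries τ u ↔
      ‖evalRep (tensorRep (unitaryRep (FreeGroup.lift u))) (FreeGroup.letterSum α)‖ =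
        2 * √(2 * (Fintype.card α : ℝ) - 1) := by
  classical
  obtain ⟨ι, c, d, hcd, hser⟩ := hτ.exists_isFaithfulSeries
  set U := FreeGroup.lift u with hU
  set φ : FreeGroup α → ℝ := fun g ↦ Complex.normSq (τ (U g : unitary M.toStarSubalgebra)) with hφ
  have hΦ := productFunctional_tensorRep hcd.summable hτ hser U
  have hφ1 : φ 1 = 1 := by
    simp only [hφ, map_one U, OneMemClass.coe_one, hτ.map_one, Complex.normSq_one]
  -- Here ρ is the norm of T itself: the first half is the lower bound, the second forces φ to be
  -- regular at equality.
  have hkesten := FreeGroup.kesten hα (φ := φ) (fun g ↦ Complex.normSq_nonneg _) hφ1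
    (fun g h ↦ hτ.normSq_conj U g h) (hτ.isPosDefFun_normSq U) (norm_nonneg _)
    (form_one_add_pow_le hΦ (FreeGroup.letterSum α))
  rw [areFreeHaarUnitaries_iff hτ.map_one]
  constructor
  · intro hfree
    refine le_antisymm ?_ hkesten.1
    refine IsSelfAdjoint.norm_le_of_moments
      (isSelfAdjoint_evalRep_letterSum (star_tensorRep (unitaryRep U)))
      (productFunctional c d (fun i ↦ riesz H (d i)) (fun i ↦ riesz H (c i)))
      (fun X hX0 hX ↦ ?_) (by positivity) fun n ↦ ?_
    -- The operators M' ⊗ 1 and 1 ⊗ (M^op)' commute with every π(g), hence with T, hence with `X`;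
    -- this is what faithfulness of the product functional requires.
    · have hXc : VonNeumannAlgebra.CommutesWithCommutants M M.opposite X :=
        ⟨fun x hx ↦ hX _ (commute_evalRep
            (fun g ↦ (commutesWithCommutants_tensorRep U g).1 x hx) _),
          fun y hy ↦ hX _ (commute_evalRep
            (fun g ↦ (commutesWithCommutants_tensorRep U g).2 y hy) _)⟩
      exact ⟨VonNeumannAlgebra.productFunctional_nonneg hXc hX0 hcd hcd.opposite,
        VonNeumannAlgebra.eq_zero_of_productFunctional_eq_zero hXc hX0 hcd hcd.opposite⟩
    · rw [apply_evalRep_pow hΦ]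
      have hφδ : (fun g ↦ Complex.normSq (τ (U g : unitary M.toStarSubalgebra))) =
          MonoidAlgebra.regularChar (FreeGroup α) := by
        funext g
        rw [MonoidAlgebra.regularChar]
        split_ifs with hg
        · rw [hg]; exact hφ1
        · rw [hfree g hg, Complex.normSq_zero]
      rw [hφδ, MonoidAlgebra.eval_regularChar, Complex.norm_real, Real.norm_of_nonneg
        (FreeGroup.isNonneg_letterSum.pow n 1)]
      exact FreeGroup.coeff_letterSum_pow_one_le (by omega) n
  · intro hnorm g hg
    exact Complex.normSq_eq_zero.1 (hkesten.2 hnorm g hg)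

end Main

theorem mainTheorem1 {H : Type*} [NormedAddCommGroup H] [InnerProductSpace ℂ H] [CompleteSpace H]
    (M : VonNeumannAlgebra H) (τ : M.toStarSubalgebra →ₗ[ℂ] ℂ) (hτ : IsFaithfulNormalTrace M τ)
    (N : ℕ) (hN : 1 < N) (u : Fin N → unitary M.toStarSubalgebra) :
    AreFreeHaarUnitaries τ u ↔
      ‖∑ i, (VonNeumannAlgebra.tmul (N := M.opposite) (u i : M.toStarSubalgebra)
              (star (M.toOpposite (u i)))
          + VonNeumannAlgebra.tmul (N := M.opposite) (star (u i : M.toStarSubalgebra))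
              (M.toOpposite (u i)))‖ = 2 * √(2 * (N : ℝ) - 1) := by
  have h := areFreeHaarUnitaries_iff_norm_eq hτ (by rwa [Fintype.card_fin]) u
  rw [Fintype.card_fin] at h
  rw [h]
  refine Eq.congr_left ?_
  -- The norm on the tensor product algebra is the operator norm on the Hilbert space tensor
  -- product.
  rw [AddSubgroupClass.coe_norm]
  refine congrArg norm ?_
  rw [evalRep_letterSum, AddSubmonoidClass.coe_finsetSum]
  refine Finset.sum_congr rfl fun i _ ↦ ?_
  rw [tensorRep_unitaryRep_apply, tensorRep_unitaryRep_inv_apply, FreeGroup.lift_apply_of]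
  rfl
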